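/- **Exponential fast-forwarding of quadratic fermionic Hamiltonians.** *Setting.* Let $\mathcal H_n$ be the Fock space of $n$ fermionic modes, with annihilation and creation operators $c_i, c_i^\dagger$. A monomial of weight $d=p+q$ is $M=c_{i_1}^\dagger\cdots c_{i_p}^\dagger c_{j_1}\cdots c_{j_q}$. In the fermionic gate model of weight at most $w$, an elementary gate is $e^{-i\theta O}$ with $\theta\in\mathbb R$, $|\theta|\le 1$ and $O=aM+(aM)^\dagger$, where $M$ is a monomial of weight at most $w$ and $a\in\mathbb C$, $|a|\le 1$; a circuit is a finite sequence of gates, and its complexity is the number of gates. Circuits $V_n(t)$ (possibly acting on additional ancillary modes $\mathcal A$ that start in the vacuum) simulate $H_n$, $n=1,2,\dots$, with parameters $(T(n),\epsilon,G(n))$ if for all $n\ge 1$ and $0\le t\le T(n)$ the circuit $V_n(t)$ has at most $G(n)$ gates and $\|(e^{-itH_n}\otimes 1-V_n(t))\,|\psi\rangle|0\rangle_{\mathcal A}\|\le\epsilon$ for every unit vector $|\psi\rangle\in\mathcal H_n$. Let $\mathcal C_n$ be the class of $n$-mode fermionic Hamiltonians of weight at most $v$: Hermitian sums, over all index tuples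 with $p+q\le v$, of terms $a\,c_{i_1}^\dagger\cdots c_{i_p}^\dagger c_{j_1}\cdots c_{j_q}$ with $|a|\le 1$. The no-fast-forwarding line is $l(n)=\max_{H\in\mathcal C_n}\min G$, the minimum being over the $G$ for which some circuits simulate $H$ for all $0\le t\le T(n)$ to error $\epsilon$ with at most $G$ gates ($l(n)=\infty$ if there is no finite bound). Circuits $V_n(t)$ are $(T(n),\epsilon,G(n))$-fast-forwarding $\{H_n\in\mathcal C_n\}_n$ if they simulate $\{H_n\}_n$ with these parameters and $\lim_{n\to\infty}G(n)/l(n)=0$; the fast-forwarding is exponential if moreover $G(n)=\mathrm{poly}(n)$ and $l(n)$ grows at least exponentially. *Theorem.* Let $\epsilon>0$, $\tau>1$ and $T(n)=\tau^n$. There is a function $G(n)=O(n^2\log T(n))$, hence $G(n)=\mathrm{poly}(n)$, such that for every sequence of quadratic fermionic Hamiltonians $$H_n=\sum_{i,j=1}^n\left(\alpha_{ij}c_i^\dagger c_j+\beta_{ij}c_ic_j-\beta_{ij}^*c_i^\dagger c_j^\dagger\right),\qquad \alpha_{ij}=\alpha_{ji}^*,\ |\alpha_{ij}|\le1,\ |\beta_{ij}|\le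 1$$ (the coefficients may depend on $n$; up to an additive constant $H_n$ is an element of $\mathfrak{so}(2n,\mathbb R)$), there are circuits $V_n(t)$, all of whose gates are generated by monomials of weight exactly $2$, that simulate $\{H_n\}_n$ with parameters $(T(n),\epsilon,G(n))$. For all constants $w,v\ge2$, in the model of weight at most $w$ and relative to the class $\mathcal C_n$ of weight at most $v$: - if $n^2\log T(n)=o(l(n))$, then these circuits are $(T(n),\epsilon,G(n))$-fast-forwarding $\{H_n\}_n$; - in particular, if $l(n)=\Omega(n\,T(n))$, then they are exponentially fast-forwarding $\{H_n\}_n$. -/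

import Mathlib

open Filter Topology
open scoped ENNReal Matrix

namespace FermionFF

noncomputable section

/-! ## The fermionic Fock space of `n` modes and its ladder operators -/

/-- The Fock space of `n` fermionic modes. The orthonormal basis vector indexed by
`S : Finset (Fin n)` is the occupation number state in which exactly the modes in `S` are
occupied. -/
abbrev Fock (n : ℕ) : Type := EuclideanSpace ℂ (Finset (Fin n))

/-- Operators on the Fock space, given by their matrices in the occupation number basis. The
Hermitian adjoint is `Mᴴ`. -/
abbrev Op (n : ℕ) : Type := Matrix (Finset (Fin n)) (Finset (Fin n)) ℂ

/-- The vector `A |ψ⟩`. -/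
def Op.apply {n : ℕ} (A : Op n) (ψ : Fock n) : Fock n := WithLp.toLp 2 (A *ᵥ WithLp.ofLp ψ)

/-- The annihilation operator `c_j`:
`c_j |T⟩ = (-1)^{#{i ∈ T | i < j}} |T \ {j}⟩` if `j ∈ T`, and `c_j |T⟩ = 0` otherwise. -/
def annihilate {n : ℕ} (j : Fin n) : Op n :=
  Matrix.of fun S T : Finset (Fin n) =>
    if j ∈ T ∧ S = T.erase j then (-1 : ℂ) ^ (T.filter (fun i => i < j)).card else 0

/-- The creation operator `c_j†`. -/
def create {n : ℕ} (j : Fin n) : Op n := (annihilate j)ᴴ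

/-- The normally ordered monomial `c†_{I 0} ⋯ c†_{I (p-1)} c_{J 0} ⋯ c_{J (q-1)}`, of weight
(equivalently, degree) `p + q`. -/
def monomialOp {n p q : ℕ} (I : Fin p → Fin n) (J : Fin q → Fin n) : Op n :=
  (List.ofFn fun k => create (I k)).prod * (List.ofFn fun k => annihilate (J k)).prod

/-! ## Fermionic Hamiltonians -/

/-- The quadratic form `∑_{i,j} (α_{ij} c_i† c_j + β_{ij} c_i c_j - β_{ij}^* c_i† c_j†)`. -/
def quadraticHamiltonian {n : ℕ} (α β : Matrix (Fin n) (Fin n) ℂ) : Op n :=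
  ∑ i, ∑ j, (α i j • (create i * annihilate j) + β i j • (annihilate i * annihilate j)
    - star (β i j) • (create i * create j))

/-- The class of `n`-mode fermionic Hamiltonians of weight at most `v`: the Hermitian operators
that are sums of terms `a c†_{i_1} ⋯ c†_{i_p} c_{j_1} ⋯ c_{j_q}` with `p + q ≤ v` and
`|a| ≤ 1`. -/
def fermionicClass (v n : ℕ) : Set (Op n) :=
  {H | H.IsHermitian ∧
    ∃ a : ∀ p q : ℕ, (Fin p → Fin n) → (Fin q → Fin n) → ℂ,
      (∀ p q I J, ‖a p q I J‖ ≤ 1) ∧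
      H = ∑ p ∈ Finset.range (v + 1), ∑ q ∈ Finset.range (v + 1 - p),
            ∑ I : Fin p → Fin n, ∑ J : Fin q → Fin n, a p q I J • monomialOp I J}

/-! ## Models of quantum computation and circuits -/

/-- A model of quantum computation on fermionic modes: the set of observables that generate the
elementary gates, for each number of modes. -/
abbrev Model : Type := ∀ n : ℕ, Set (Op n)

/-- The observables consisting of one fermionic term of weight exactly `d` and its Hermitian
conjugate: `a M + (a M)†`, where `|a| ≤ 1` and `M` is a normally ordered monomial of
weight `d`. -/
def termObservables (d : ℕ) : Model := fun n =>
  {O | ∃ (p q : ℕ) (I : Fin p → Fin n) (J : Fin q → Fin n) (a : ℂ),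
    p + q = d ∧ ‖a‖ ≤ 1 ∧ O = a • monomialOp I J + (a • monomialOp I J)ᴴ}

/-- The fermionic gate model whose observables have weight at most `w`. -/
def fermionicModel (w : ℕ) : Model := fun n => {O | ∃ d ≤ w, O ∈ termObservables d n}

/-- The data of an elementary gate: an observable and a phase. -/
structure Gate (n : ℕ) where
  observable : Op n
  phase : ℝ

/-- The gate unitary `e^{-i θ O}`. -/
def Gate.unitary {n : ℕ} (g : Gate n) : Op n :=
  NormedSpace.exp ((-(Complex.I * (g.phase : ℂ))) • g.observable)

/-- A circuit is a finite sequence of gates; its length is its quantum complexity. -/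
abbrev Circuit (n : ℕ) : Type := List (Gate n)

/-- The operator implemented by a circuit (the rightmost gate acts first). -/
def circuitOp {n : ℕ} (c : Circuit n) : Op n := (c.map Gate.unitary).prod

/-- All gates of the circuit are elementary gates of the model: they are `e^{-i θ O}` with `O` an
observable of the model and `|θ| ≤ 1`. -/
def Circuit.InModel {n : ℕ} (𝔥 : Model) (c : Circuit n) : Prop :=
  ∀ g ∈ c, g.observable ∈ 𝔥 n ∧ |g.phase| ≤ 1

/-! ## Hamiltonian simulation -/

/-- `ψ ↦ ψ ⊗ |0⟩`: adjoin an ancillary register of `m` modes in the vacuum state. -/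
def adjoinVacuum {n : ℕ} (m : ℕ) (ψ : Fock n) : Fock (n + m) :=
  ∑ S : Finset (Fin n), ψ S • EuclideanSpace.single (S.map (Fin.castAddEmb m)) (1 : ℂ)

/-- The evolution operator `e^{-i t H}`. -/
def evolution {n : ℕ} (H : Op n) (t : ℝ) : Op n :=
  NormedSpace.exp ((-(Complex.I * (t : ℂ))) • H)

/-- The circuits `V t`, with `m` ancillary modes, simulate `H` in the model `𝔥` for all times
`0 ≤ t ≤ T`, with error at most `ε` on every state and with at most `G` gates. -/
def Simulates (𝔥 : Model) {n m : ℕ} (H : Op n) (V : ℝ → Circuit (n + m)) (T ε : ℝ) (G : ℕ) :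
    Prop :=
  ∀ t : ℝ, 0 ≤ t → t ≤ T →
    (V t).InModel 𝔥 ∧ (V t).length ≤ G ∧
    ∀ ψ : Fock n, ‖ψ‖ = 1 →
      ‖adjoinVacuum m ((evolution H t).apply ψ) - (circuitOp (V t)).apply (adjoinVacuum m ψ)‖ ≤ ε

/-- A family of circuits `V_n(t)`, where `V_n(t)` acts on the `n` system modes and on a register
of `ancilla n` ancillary modes. -/
structure CircuitFamily where
  ancilla : ℕ → ℕ
  circuit : ∀ n : ℕ, ℝ → Circuit (n + ancilla n)

/-- The circuits `{V_n(t)}` simulate the Hamiltonians `{H_n}`, `n = 1, 2, …`, with parameters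
`(T(n), ε(n), G(n))`. -/
def FamilySimulates (𝔥 : Model) (H : ∀ n, Op n) (V : CircuitFamily) (T ε : ℕ → ℝ) (G : ℕ → ℕ) :
    Prop :=
  ∀ n, 1 ≤ n → Simulates 𝔥 (H n) (V.circuit n) (T n) (ε n) (G n)

/-- The no-fast-forwarding line `l(n) = max_{H ∈ C_n} min_{V} G`: the number of gates with which
every Hamiltonian of the class `C_n` can be simulated for all times up to `T(n)` within error
`ε(n)`. It is `⊤` if no finite number of gates suffices. -/
def noFFLine (𝔥 : Model) (C : ∀ n, Set (Op n)) (T ε : ℕ → ℝ) (n : ℕ) : ℕ∞ :=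
  ⨆ H ∈ C n, ⨅ G ∈ {G : ℕ | ∃ (m : ℕ) (V : ℝ → Circuit (n + m)),
    Simulates 𝔥 H V (T n) (ε n) G}, (G : ℕ∞)

/-- The circuits `{V_n(t)}` are `(T(n), ε(n), G(n))`-fast-forwarding the Hamiltonians
`{H_n ∈ C_n}`: they simulate them with these parameters, and `G(n) / l(n) → 0`. -/
def FastForwards (𝔥 : Model) (C : ∀ n, Set (Op n)) (H : ∀ n, Op n) (V : CircuitFamily)
    (T ε : ℕ → ℝ) (G : ℕ → ℕ) : Prop :=
  (∀ n, 1 ≤ n → H n ∈ C n) ∧ FamilySimulates 𝔥 H V T ε G ∧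
    Tendsto (fun n => (G n : ℝ≥0∞) / (noFFLine 𝔥 C T ε n : ℝ≥0∞)) atTop (𝓝 0)

/-- `G(n) = poly(n)`. -/
def PolyBounded (G : ℕ → ℕ) : Prop :=
  ∃ (K : ℝ) (d : ℕ), ∀ n : ℕ, 1 ≤ n → (G n : ℝ) ≤ K * (n : ℝ) ^ d

/-- `l(n)` grows at least exponentially in `n`. -/
def GrowsExponentially (l : ℕ → ℕ∞) : Prop :=
  ∃ c b : ℝ, 0 < c ∧ 1 < b ∧ ∀ᶠ n in atTop, ENNReal.ofReal (c * b ^ n) ≤ (l n : ℝ≥0∞)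

/-- Exponential fast-forwarding: fast-forwarding with a polynomial number of gates, relative to an
exponentially large no-fast-forwarding line. -/
def ExponentiallyFastForwards (𝔥 : Model) (C : ∀ n, Set (Op n)) (H : ∀ n, Op n)
    (V : CircuitFamily) (T ε : ℕ → ℝ) (G : ℕ → ℕ) : Prop :=
  FastForwards 𝔥 C H V T ε G ∧ PolyBounded G ∧ GrowsExponentially (noFFLine 𝔥 C T ε)

end

end FermionFF

namespace FermionFF

noncomputable section

/-! ## Canonical anticommutation relations -/

/-! The evolution under a quadratic Hamiltonian is determined up to phase by a rotation of the
2n-dimensional real span of the Majorana operators, and the cost of building a rotation from plane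
rotations does not depend on how long it took to reach it. Commutation with a skew-Hermitian
quadratic operator acts on this span as a real antisymmetric matrix A
(`isRotationGenerator_of_mem`), so integrating the Heisenberg equation shows that its exponential
implements exp A (`IsRotationGenerator.exists_implements`). Time enters only through this matrix.

Givens elimination writes any rotation as at most (2n)² plane rotations with angles in [-π, π]
(`IsRotation.exists_isPlaneRotationProduct`), and each of them is implemented exactly by four gates
of weight 2 (`exists_implementable_planeRotation`). The resulting unitary agrees with the evolution
up to a phase, because the Fock representation is irreducible (`Implements.exists_phase`).
Simulation is not taken modulo phase, so the phase must also be produced by gates of weight 2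
(`implementable_phase`).

The outcome is `implementable_evolution`: 16n² + 22 gates, zero error and no ancillas, for every t.
The bound O(n² log T) and the comparison with the no-fast-forwarding line are then elementary growth
estimates. -/

/-- The Jordan–Wigner sign of the mode `j` in the occupation state `T`. -/
def jwSign {n : ℕ} (j : Fin n) (T : Finset (Fin n)) : ℂ :=
  (-1 : ℂ) ^ (T.filter (fun i => i < j)).card

lemma jwSign_mul_self {n : ℕ} (j : Fin n) (T : Finset (Fin n)) :
    jwSign j T * jwSign j T = 1 := by
  unfold jwSign
  rw [← pow_add, ← two_mul, pow_mul]; simp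

lemma jwSign_ne_zero {n : ℕ} (j : Fin n) (T : Finset (Fin n)) : jwSign j T ≠ 0 := by
  unfold jwSign; exact pow_ne_zero _ (by norm_num)

lemma star_jwSign {n : ℕ} (j : Fin n) (T : Finset (Fin n)) :
    (starRingEnd ℂ) (jwSign j T) = jwSign j T := by
  unfold jwSign; simp

lemma jwSign_insert {n : ℕ} {i j : Fin n} {T : Finset (Fin n)} (h : j ∉ T) :
    jwSign i (insert j T) = if j < i then -jwSign i T else jwSign i T := by
  unfold jwSign
  rw [Finset.filter_insert]
  split_ifs with hji
  · rw [Finset.card_insert_of_notMem (by simp [h]), pow_succ]; ring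
  · rfl

lemma jwSign_erase {n : ℕ} {i j : Fin n} {T : Finset (Fin n)} (h : j ∈ T) :
    jwSign i (T.erase j) = if j < i then -jwSign i T else jwSign i T := by
  have := jwSign_insert (i := i) (Finset.notMem_erase j T)
  rw [Finset.insert_erase h] at this
  rw [this]; split_ifs <;> simp

lemma annihilate_apply {n : ℕ} (j : Fin n) (S T : Finset (Fin n)) :
    annihilate j S T = if j ∈ T ∧ S = T.erase j then jwSign j T else 0 := rfl

/-- Solving for the column in terms of the row collapses the sum in a product with `annihilate j` on
the left, as `annihilate_apply` does on the right. The sign is unchanged because it counts only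
modes strictly below `j`. -/
lemma annihilate_apply' {n : ℕ} (j : Fin n) (S T : Finset (Fin n)) :
    annihilate j S T = if j ∉ S ∧ T = insert j S then jwSign j S else 0 := by
  rw [annihilate_apply]
  by_cases h : j ∈ T ∧ S = T.erase j
  · obtain ⟨h1, rfl⟩ := h
    rw [if_pos ⟨h1, rfl⟩, if_pos ⟨Finset.notMem_erase _ _, (Finset.insert_erase h1).symm⟩,
      jwSign_erase h1]
    simp
  · rw [if_neg h, if_neg]
    rintro ⟨h1, rfl⟩
    exact h ⟨Finset.mem_insert_self _ _, (Finset.erase_insert h1).symm⟩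

lemma mul_annihilate_apply {n : ℕ} (A : Op n) (j : Fin n) (S T : Finset (Fin n)) :
    (A * annihilate j) S T = if j ∈ T then A S (T.erase j) * jwSign j T else 0 := by
  rw [Matrix.mul_apply]
  by_cases h : j ∈ T <;> simp [annihilate_apply, h]

lemma annihilate_mul_apply {n : ℕ} (A : Op n) (j : Fin n) (S T : Finset (Fin n)) :
    (annihilate j * A) S T = if j ∉ S then jwSign j S * A (insert j S) T else 0 := by
  rw [Matrix.mul_apply]
  by_cases h : j ∈ S <;> simp [annihilate_apply', h]

lemma create_apply {n : ℕ} (j : Fin n) (S T : Finset (Fin n)) :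
    create j S T = if j ∉ T ∧ S = insert j T then jwSign j T else 0 := by
  rw [create, Matrix.conjTranspose_apply, annihilate_apply', apply_ite star]
  simp [star_jwSign]

lemma create_apply' {n : ℕ} (j : Fin n) (S T : Finset (Fin n)) :
    create j S T = if j ∈ S ∧ T = S.erase j then jwSign j S else 0 := by
  rw [create, Matrix.conjTranspose_apply, annihilate_apply, apply_ite star]
  simp [star_jwSign]

lemma mul_create_apply {n : ℕ} (A : Op n) (j : Fin n) (S T : Finset (Fin n)) :
    (A * create j) S T = if j ∉ T then A S (insert j T) * jwSign j T else 0 := by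
  rw [Matrix.mul_apply]
  by_cases h : j ∈ T <;> simp [create_apply, h]

lemma create_mul_apply {n : ℕ} (A : Op n) (j : Fin n) (S T : Finset (Fin n)) :
    (create j * A) S T = if j ∈ S then jwSign j S * A (S.erase j) T else 0 := by
  rw [Matrix.mul_apply]
  by_cases h : j ∈ S <;> simp [create_apply', h]

@[simp] lemma conjTranspose_annihilate {n : ℕ} (j : Fin n) : (annihilate j)ᴴ = create j := rfl

@[simp] lemma conjTranspose_create {n : ℕ} (j : Fin n) : (create j)ᴴ = annihilate j :=
  Matrix.conjTranspose_conjTranspose _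

/-- Removing the smaller of two modes flips the sign of the larger, but not conversely, so the two
orders of removal differ by exactly one sign. -/
lemma annihilate_anticomm {n : ℕ} (i j : Fin n) :
    annihilate i * annihilate j + annihilate j * annihilate i = 0 := by
  ext S T
  rw [Matrix.add_apply, mul_annihilate_apply, mul_annihilate_apply]
  simp only [annihilate_apply, Matrix.zero_apply]
  by_cases hij : i = j
  · subst hij; simp
  by_cases hi : i ∈ T <;> by_cases hj : j ∈ T <;> simp [hi, hj, hij, Ne.symm hij]
  rw [Finset.erase_right_comm (a := i) (b := j)]
  split_ifs
  · rw [jwSign_erase hj, jwSign_erase hi]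
    rcases lt_or_gt_of_ne hij with h | h <;> simp [h, h.not_gt] <;> ring
  · simp

lemma create_anticomm {n : ℕ} (i j : Fin n) :
    create i * create j + create j * create i = 0 := by
  have := congrArg Matrix.conjTranspose (annihilate_anticomm j i)
  simpa [Matrix.conjTranspose_add, Matrix.conjTranspose_mul] using this

lemma annihilate_create_anticomm {n : ℕ} (i j : Fin n) :
    annihilate i * create j + create j * annihilate i = if i = j then 1 else 0 := by
  ext S T
  rw [Matrix.add_apply, mul_create_apply, mul_annihilate_apply]
  simp only [annihilate_apply, create_apply]
  by_cases hij : i = j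
  · subst hij
    by_cases hi : i ∈ T
    · simp [hi, Matrix.one_apply, jwSign_erase, jwSign_mul_self]
    · simp [hi, Matrix.one_apply, jwSign_insert, jwSign_mul_self]
  · by_cases hi : i ∈ T <;> by_cases hj : j ∈ T <;> simp [hi, hj, hij, Ne.symm hij]
    rw [Finset.erase_insert_of_ne (Ne.symm hij)]
    split_ifs
    · rw [jwSign_erase hi, jwSign_insert hj]
      rcases lt_or_gt_of_ne hij with h | h <;> simp [h, h.not_gt] <;> ring
    · simp

lemma annihilate_sq {n : ℕ} (i : Fin n) : annihilate i * annihilate i = 0 := by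
  ext S T
  rw [mul_annihilate_apply]; simp [annihilate_apply]

lemma create_sq {n : ℕ} (i : Fin n) : create i * create i = 0 := by
  have := congrArg Matrix.conjTranspose (annihilate_sq i)
  simpa [Matrix.conjTranspose_mul] using this

lemma create_mul_annihilate_eq_diagonal {n : ℕ} (j : Fin n) :
    create j * annihilate j = Matrix.diagonal fun S => if j ∈ S then (1 : ℂ) else 0 := by
  ext S T
  rw [mul_annihilate_apply, create_apply, Matrix.diagonal_apply]
  by_cases hj : j ∈ T
  · simp only [hj, if_true, Finset.notMem_erase, not_false_eq_true, true_and,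
      Finset.insert_erase hj]
    by_cases h : S = T
    · subst h; simp [hj, jwSign_erase, jwSign_mul_self]
    · simp [h]
  · simp only [hj, if_false]
    by_cases h : S = T
    · subst h; simp [hj]
    · simp [h]

/-- The Fock representation is irreducible: only scalars commute with all ladder operators. -/
lemma eq_smul_one_of_commute {n : ℕ} (W : Op n)
    (h : ∀ j, Commute W (annihilate j)) (h' : ∀ j, Commute W (create j)) :
    W = W ∅ ∅ • (1 : Op n) := by
  have off1 : ∀ S T : Finset (Fin n), ∀ j, j ∈ S → j ∉ T → W S T = 0 := by
    intro S T j hS hT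
    -- At this entry `W * annihilate j` vanishes since `j ∉ T`, while `annihilate j * W` is a sign
    -- times `W S T`.
    have := congrFun (congrFun (h j).eq (S.erase j)) T
    rw [mul_annihilate_apply, annihilate_mul_apply] at this
    simpa [hT, Finset.insert_erase hS, jwSign_ne_zero] using this.symm
  have off2 : ∀ S T : Finset (Fin n), ∀ j, j ∉ S → j ∈ T → W S T = 0 := by
    intro S T j hS hT
    have := congrFun (congrFun (h' j).eq S) (T.erase j)
    rw [mul_create_apply, create_mul_apply] at this
    simpa [hS, Finset.insert_erase hT, jwSign_ne_zero] using this
  have diag : ∀ S : Finset (Fin n), W S S = W ∅ ∅ := by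
    intro S
    induction S using Finset.induction_on with
    | empty => rfl
    | insert j S hj ih =>
      have := congrFun (congrFun (h j).eq S) (insert j S)
      rw [mul_annihilate_apply, annihilate_mul_apply] at this
      simp only [Finset.mem_insert_self, if_true, Finset.erase_insert hj, hj, not_false_eq_true,
        jwSign_insert hj, lt_irrefl, if_false] at this
      rw [← ih]
      rw [mul_comm] at this
      exact (mul_left_cancel₀ (jwSign_ne_zero j S) this).symm
  ext S T
  rw [Matrix.smul_apply, Matrix.one_apply]
  by_cases hST : S = T
  · subst hST; simp [diag]
  · rw [if_neg hST, smul_zero]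
    by_contra hne
    apply hST
    ext j
    constructor
    · intro hS; by_contra hT; exact hne (off1 S T j hS hT)
    · intro hT; by_contra hS; exact hne (off2 S T j hS hT)

/-! ## Plane rotations generate the special orthogonal group -/

section PlaneRotation

variable {ι : Type*} [Fintype ι] [DecidableEq ι]

/-- The rotation by the angle `θ` in the coordinate plane `(a, b)`. -/
def planeRotation (a b : ι) (θ : ℝ) : Matrix ι ι ℝ :=
  Matrix.of fun i =>
    if i = a then Real.cos θ • Pi.single a 1 - Real.sin θ • Pi.single b 1
    else if i = b then Real.sin θ • Pi.single a 1 + Real.cos θ • Pi.single b 1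
    else Pi.single i 1

lemma planeRotation_mul_apply (a b : ι) (θ : ℝ) (R : Matrix ι ι ℝ) (i k : ι) :
    (planeRotation a b θ * R) i k =
      if i = a then Real.cos θ * R a k - Real.sin θ * R b k
      else if i = b then Real.sin θ * R a k + Real.cos θ * R b k
      else R i k := by
  rw [Matrix.mul_apply]
  simp only [planeRotation, Matrix.of_apply]
  split_ifs <;>
    simp [Pi.single_apply, sub_mul, add_mul, Finset.sum_sub_distrib, Finset.sum_add_distrib]

lemma planeRotation_mul_planeRotation {a b : ι} (hab : a ≠ b) (θ φ : ℝ) :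
    planeRotation a b θ * planeRotation a b φ = planeRotation a b (θ + φ) := by
  ext i k
  rw [planeRotation_mul_apply]
  simp only [planeRotation, Matrix.of_apply, if_true, if_neg hab.symm, Real.cos_add, Real.sin_add]
  split_ifs <;> simp <;> ring

omit [Fintype ι] in
lemma planeRotation_zero (a b : ι) : planeRotation a b 0 = 1 := by
  ext i k
  simp only [planeRotation, Matrix.of_apply, Matrix.one_apply]
  split_ifs <;> simp_all [eq_comm]

omit [Fintype ι] in
lemma transpose_planeRotation {a b : ι} (hab : a ≠ b) (θ : ℝ) :
    (planeRotation a b θ)ᵀ = planeRotation a b (-θ) := by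
  ext i k
  simp only [planeRotation, Matrix.transpose_apply, Matrix.of_apply, Real.cos_neg, Real.sin_neg]
  by_cases hia : i = a <;> by_cases hib : i = b <;> by_cases hka : k = a <;>
    by_cases hkb : k = b <;> simp_all [Pi.single_apply, eq_comm]

/-- Membership in the special orthogonal group, with the determinant condition relaxed to
positivity. -/
def IsRotation (R : Matrix ι ι ℝ) : Prop := Rᵀ * R = 1 ∧ 0 < R.det

lemma IsRotation.mul {R S : Matrix ι ι ℝ} (hR : IsRotation R) (hS : IsRotation S) :
    IsRotation (R * S) := by
  refine ⟨?_, ?_⟩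
  · rw [Matrix.transpose_mul, Matrix.mul_assoc, ← Matrix.mul_assoc Rᵀ, hR.1, Matrix.one_mul, hS.1]
  · rw [Matrix.det_mul]; exact mul_pos hR.2 hS.2

lemma isRotation_planeRotation {a b : ι} (hab : a ≠ b) (θ : ℝ) :
    IsRotation (planeRotation a b θ) := by
  have h1 : ∀ φ : ℝ, (planeRotation a b φ)ᵀ * planeRotation a b φ = 1 := fun φ => by
    rw [transpose_planeRotation hab, planeRotation_mul_planeRotation hab, neg_add_cancel,
      planeRotation_zero]
  refine ⟨h1 θ, ?_⟩
  -- Being the square of its half-angle rotation Q, the matrix has determinant det Q · det Q =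
  -- det(QᵀQ) = 1.
  have h2 : planeRotation a b θ = planeRotation a b (θ / 2) * planeRotation a b (θ / 2) := by
    rw [planeRotation_mul_planeRotation hab, add_halves]
  rw [h2, Matrix.det_mul]
  have h3 := congrArg Matrix.det (h1 (θ / 2))
  rw [Matrix.det_mul, Matrix.det_transpose, Matrix.det_one] at h3
  rw [h3]; exact one_pos

/-- `R` is a product of `k` plane rotations. -/
inductive IsPlaneRotationProduct : ℕ → Matrix ι ι ℝ → Prop
  | one : IsPlaneRotationProduct 0 1
  | rotation_mul {k : ℕ} {R : Matrix ι ι ℝ} (a b : ι) (θ : ℝ) (hab : a ≠ b) (hθ : |θ| ≤ Real.pi)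
      (hR : IsPlaneRotationProduct k R) : IsPlaneRotationProduct (k + 1) (planeRotation a b θ * R)

/-- Elimination multiplies by rotations until the identity is reached; undoing one of them costs one
rotation by the opposite angle. -/
lemma IsPlaneRotationProduct.of_rotation_mul {k : ℕ} {R : Matrix ι ι ℝ} {a b : ι} {θ : ℝ}
    (hab : a ≠ b) (hθ : |θ| ≤ Real.pi) (h : IsPlaneRotationProduct k (planeRotation a b θ * R)) :
    IsPlaneRotationProduct (k + 1) R := by
  have := IsPlaneRotationProduct.rotation_mul a b (-θ) hab (by rwa [abs_neg]) h
  rwa [← Matrix.mul_assoc, planeRotation_mul_planeRotation hab, neg_add_cancel,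
    planeRotation_zero, Matrix.one_mul] at this

/-- The argument of x - iy turns the vector (x, y) onto the nonnegative first axis. The
nonnegativity later excludes a pivot equal to -1. -/
lemma exists_rotation_angle (x y : ℝ) : ∃ θ : ℝ, |θ| ≤ Real.pi ∧
    Real.sin θ * x + Real.cos θ * y = 0 ∧ 0 ≤ Real.cos θ * x - Real.sin θ * y := by
  set z : ℂ := ⟨x, -y⟩ with hz
  have hx : ‖z‖ * Real.cos z.arg = x := Complex.norm_mul_cos_arg z
  have hy : ‖z‖ * Real.sin z.arg = -y := Complex.norm_mul_sin_arg z
  refine ⟨z.arg, Complex.abs_arg_le_pi z, ?_, ?_⟩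
  · rw [← hx, ← neg_neg y, ← hy]; ring
  · have : Real.cos z.arg * x - Real.sin z.arg * y = ‖z‖ := by
      calc _ = Real.cos z.arg * x + Real.sin z.arg * (-y) := by ring
        _ = ‖z‖ * (Real.sin z.arg ^ 2 + Real.cos z.arg ^ 2) := by rw [← hx, ← hy]; ring
        _ = ‖z‖ := by rw [Real.sin_sq_add_cos_sq, mul_one]
    rw [this]; exact norm_nonneg z

/-- Plane rotations clear the entries of column `a` in the rows of `B`, leaving the columns that
are already unit vectors intact. -/
lemma exists_clear_column {a : ι} {S : Finset ι} (haS : a ∉ S) {R : Matrix ι ι ℝ}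
    (hR : IsRotation R) (hfix : ∀ c, c ∉ insert a S → ∀ i, R i c = if i = c then 1 else 0)
    (B : Finset ι) (hB : B ⊆ S) :
    ∃ (R' : Matrix ι ι ℝ) (k : ℕ), k ≤ B.card ∧ IsRotation R' ∧
      (∀ c, c ∉ insert a S → ∀ i, R' i c = if i = c then 1 else 0) ∧
      (∀ b ∈ B, R' b a = 0) ∧ (B.Nonempty → 0 ≤ R' a a) ∧
      ∀ j, IsPlaneRotationProduct j R' → IsPlaneRotationProduct (j + k) R := by
  induction B using Finset.induction_on with
  | empty => exact ⟨R, 0, le_rfl, hR, hfix, by simp, by simp, fun j hj => hj⟩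
  | insert b B hb ih =>
    obtain ⟨R', k, hk, hR', hfix', hzero, -, hprod⟩ :=
      ih ((Finset.subset_insert _ _).trans hB)
    have hbS : b ∈ S := hB (Finset.mem_insert_self _ _)
    have hab : a ≠ b := fun h => haS (h ▸ hbS)
    have haB : a ∉ B := fun h => haS (hB (Finset.mem_insert_of_mem h))
    obtain ⟨θ, hθ, h0, hpos⟩ := exists_rotation_angle (R' a a) (R' b a)
    refine ⟨planeRotation a b θ * R', k + 1, ?_, (isRotation_planeRotation hab θ).mul hR', ?_, ?_,
      ?_, ?_⟩
    · rw [Finset.card_insert_of_notMem hb]; omega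
    -- A finished column vanishes in rows `a` and `b`, so mixing these two rows leaves it unchanged.
    · intro c hc i
      have hca : a ≠ c := fun h => hc (h ▸ Finset.mem_insert_self _ _)
      have hcb : b ≠ c := fun h => hc (h ▸ Finset.mem_insert_of_mem hbS)
      rw [planeRotation_mul_apply]
      simp only [hfix' c hc, if_neg hca, if_neg hcb]
      split_ifs <;> simp_all
    · intro b' hb'
      rw [planeRotation_mul_apply]
      rcases Finset.mem_insert.1 hb' with rfl | hb'
      · rw [if_neg hab.symm, if_pos rfl, h0]
      · rw [if_neg (show b' ≠ a from fun h => haB (h ▸ hb')),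
        if_neg (show b' ≠ b from fun h => hb (h ▸ hb')), hzero b' hb']
    · intro _
      rw [planeRotation_mul_apply, if_pos rfl]; exact hpos
    · intro j hj
      have := hprod _ (hj.of_rotation_mul hab hθ)
      rwa [show j + (k + 1) = j + 1 + k by omega]

/-- Givens elimination, with `S` the set of columns that need not yet be unit vectors. Clearing a
column within the rows of `S` suffices: orthogonality clears its other off-diagonal entries and
makes the pivot ±1. -/
lemma IsRotation.exists_isPlaneRotationProduct_of_fixes (S : Finset ι) {R : Matrix ι ι ℝ}
    (hR : IsRotation R) (hfix : ∀ c, c ∉ S → ∀ i, R i c = if i = c then 1 else 0) :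
    ∃ k, k ≤ S.card * Fintype.card ι ∧ IsPlaneRotationProduct k R := by
  induction S using Finset.induction_on generalizing R with
  | empty =>
    have : R = 1 := by
      ext i c
      rw [hfix c (Finset.notMem_empty c), Matrix.one_apply]
    exact ⟨0, Nat.zero_le _, this ▸ .one⟩
  | insert a S haS ih =>
    obtain ⟨R', k, hk, hR', hfix', hzero, hpos, hprod⟩ :=
      exists_clear_column haS hR hfix S subset_rfl
    -- Column `c` is the unit vector at `c`, so its inner product with column `a` is this entry.
    have hrow : ∀ c, c ∉ insert a S → R' c a = 0 := by
      intro c hc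
      have hca : c ≠ a := fun h => hc (h ▸ Finset.mem_insert_self _ _)
      have := congrFun (congrFun hR'.1 c) a
      rw [Matrix.mul_apply, Matrix.one_apply_ne hca] at this
      simpa [Matrix.transpose_apply, hfix' c hc] using this
    have hcol : ∀ i, i ≠ a → R' i a = 0 := by
      intro i hi
      by_cases hiS : i ∈ S
      · exact hzero i hiS
      · exact hrow i (by simp [hi, hiS])
    have hsq : R' a a * R' a a = 1 := by
      have := congrFun (congrFun hR'.1 a) a
      rw [Matrix.mul_apply, Matrix.one_apply_eq, Finset.sum_eq_single a] at this
      · exact this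
      · intro i _ hi; rw [hcol i hi, mul_zero]
      · simp
    have haa : R' a a = 1 := by
      have hnn : 0 ≤ R' a a := by
        -- For the last column there is no row left to rotate with; the matrix is then diagonal with
        -- determinant equal to the pivot, and the positive determinant fixes the sign.
        rcases S.eq_empty_or_nonempty with rfl | hne
        · have hdiag : R' = Matrix.diagonal fun i => R' i i := by
            ext i c
            rw [Matrix.diagonal_apply]
            by_cases hc : c = a
            · subst hc
              split_ifs with h
              · rw [h]
              · exact hcol i h
            · have hc' : c ∉ insert a (∅ : Finset ι) := by simpa using hc
              rw [hfix' c hc']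
              split_ifs with h
              · subst h; rw [hfix' i hc', if_pos rfl]
              · rfl
          have hdet := hR'.2
          rw [hdiag, Matrix.det_diagonal, Finset.prod_eq_single a] at hdet
          · exact hdet.le
          · intro c _ hc
            rw [hfix' c (by simpa using hc), if_pos rfl]
          · simp
        · exact hpos hne
      nlinarith
    obtain ⟨j, hj, hprod'⟩ := ih hR' (by
      intro c hc i
      by_cases hca : c = a
      · subst hca
        split_ifs with h
        · rw [h, haa]
        · exact hcol i h
      · exact hfix' c (by simp [hca, hc]) i)
    refine ⟨j + k, ?_, hprod j hprod'⟩
    rw [Finset.card_insert_of_notMem haS, add_mul, one_mul]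
    exact add_le_add hj (hk.trans (Finset.card_le_univ S))

/-- Every rotation of `ℝ^N` is a product of at most `N²` plane rotations. -/
theorem IsRotation.exists_isPlaneRotationProduct {R : Matrix ι ι ℝ} (hR : IsRotation R) :
    ∃ k, k ≤ Fintype.card ι * Fintype.card ι ∧ IsPlaneRotationProduct k R :=
  hR.exists_isPlaneRotationProduct_of_fixes Finset.univ (fun c hc => absurd (Finset.mem_univ c) hc)

open scoped Matrix.Norms.Operator in
/-- The exponential of a real antisymmetric matrix is a rotation. -/
lemma isRotation_exp {A : Matrix ι ι ℝ} (hA : Aᵀ = -A) : IsRotation (NormedSpace.exp A) := by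
  have key : ∀ B : Matrix ι ι ℝ, Bᵀ = -B → (NormedSpace.exp B)ᵀ * NormedSpace.exp B = 1 := by
    intro B hB
    rw [← Matrix.exp_transpose, hB, ← Matrix.exp_add_of_commute _ _ (Commute.refl B).neg_left,
      neg_add_cancel, NormedSpace.exp_zero]
  refine ⟨key A hA, ?_⟩
  -- Halving the exponent exhibits the determinant as a square, as for plane rotations.
  have h2 : NormedSpace.exp A
      = NormedSpace.exp ((1 / 2 : ℝ) • A) * NormedSpace.exp ((1 / 2 : ℝ) • A) := by
    rw [← Matrix.exp_add_of_commute _ _ (Commute.refl _), ← add_smul]; norm_num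
  have h3 := congrArg Matrix.det (key ((1 / 2 : ℝ) • A) (by rw [Matrix.transpose_smul, hA, smul_neg]))
  rw [Matrix.det_mul, Matrix.det_transpose, Matrix.det_one] at h3
  rw [h2, Matrix.det_mul, h3]; exact one_pos

end PlaneRotation

/-! ## Majorana operators -/

/-- The phases `1` and `i` of the two Majorana operators of a mode. -/
def majoranaPhase (x : Bool) : ℂ := if x then Complex.I else 1

/-- The Majorana operators `c_j + c_j†` and `i (c_j - c_j†)` of the mode `j`. -/
def majorana {n : ℕ} (a : Fin n × Bool) : Op n :=
  majoranaPhase a.2 • annihilate a.1 + star (majoranaPhase a.2) • create a.1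

lemma conjTranspose_majorana {n : ℕ} (a : Fin n × Bool) : (majorana a)ᴴ = majorana a := by
  simp [majorana, Matrix.conjTranspose_add, Matrix.conjTranspose_smul, add_comm]

lemma majorana_anticomm {n : ℕ} (a b : Fin n × Bool) :
    majorana a * majorana b + majorana b * majorana a = if a = b then 2 else 0 := by
  obtain ⟨i, x⟩ := a
  obtain ⟨j, y⟩ := b
  have key : majorana (i, x) * majorana (j, y) + majorana (j, y) * majorana (i, x)
      = (majoranaPhase x * majoranaPhase y) •
          (annihilate i * annihilate j + annihilate j * annihilate i)
        + (majoranaPhase x * star (majoranaPhase y)) •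
          (annihilate i * create j + create j * annihilate i)
        + (star (majoranaPhase x) * majoranaPhase y) •
          (annihilate j * create i + create i * annihilate j)
        + (star (majoranaPhase x) * star (majoranaPhase y)) •
          (create i * create j + create j * create i) := by
    simp only [majorana, mul_add, add_mul, smul_mul_assoc, mul_smul_comm, smul_add, smul_smul]
    rw [mul_comm (majoranaPhase y) (majoranaPhase x),
      mul_comm (majoranaPhase y) (star (majoranaPhase x)),
      mul_comm (star (majoranaPhase y)) (majoranaPhase x),
      mul_comm (star (majoranaPhase y)) (star (majoranaPhase x))]
    abel
  rw [key, annihilate_anticomm, create_anticomm, annihilate_create_anticomm,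
    annihilate_create_anticomm, smul_zero, smul_zero, zero_add, add_zero]
  by_cases hij : i = j
  · subst hij
    simp only [if_true, Prod.mk.injEq, true_and, ← add_smul]
    cases x <;> cases y <;> simp [majoranaPhase]
    all_goals norm_num
    all_goals exact (Algebra.algebraMap_eq_smul_one (2 : ℂ)).symm
  · simp [hij, Ne.symm hij]

lemma majorana_mul_self {n : ℕ} (a : Fin n × Bool) : majorana a * majorana a = 1 := by
  have := majorana_anticomm a a
  rw [if_pos rfl, ← two_smul ℂ] at this
  have h2 : (2 : Op n) = (2 : ℂ) • (1 : Op n) := by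
    rw [two_smul, one_add_one_eq_two]
  rw [h2] at this
  exact smul_right_injective _ (two_ne_zero) this

lemma majorana_mul_of_ne {n : ℕ} {a b : Fin n × Bool} (h : a ≠ b) :
    majorana a * majorana b = -(majorana b * majorana a) := by
  have := majorana_anticomm a b
  rw [if_neg h] at this
  exact eq_neg_of_add_eq_zero_left this

lemma annihilate_eq_majorana {n : ℕ} (j : Fin n) : annihilate j =
    (1 / 2 : ℂ) • majorana (j, false) + (-Complex.I / 2) • majorana (j, true) := by
  simp only [majorana, majoranaPhase, if_true, Bool.false_eq_true, if_false, smul_add, smul_smul,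
    star_one, Complex.star_def, Complex.conj_I]
  have h1 : -Complex.I / 2 * Complex.I = 1 / 2 := by linear_combination (-1 / 2 : ℂ) * Complex.I_sq
  have h2 : -Complex.I / 2 * -Complex.I = -(1 / 2) := by
    linear_combination (1 / 2 : ℂ) * Complex.I_sq
  rw [h1, h2]
  module

lemma create_eq_majorana {n : ℕ} (j : Fin n) : create j =
    (1 / 2 : ℂ) • majorana (j, false) + (Complex.I / 2) • majorana (j, true) := by
  simp only [majorana, majoranaPhase, if_true, Bool.false_eq_true, if_false, smul_add, smul_smul,
    star_one, Complex.star_def, Complex.conj_I]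
  have h1 : Complex.I / 2 * Complex.I = -(1 / 2) := by
    linear_combination (1 / 2 : ℂ) * Complex.I_sq
  have h2 : Complex.I / 2 * -Complex.I = 1 / 2 := by
    linear_combination (-1 / 2 : ℂ) * Complex.I_sq
  rw [h1, h2]
  module

lemma eq_smul_one_of_commute_majorana {n : ℕ} (W : Op n) (h : ∀ a, Commute W (majorana a)) :
    W = W ∅ ∅ • (1 : Op n) := by
  apply eq_smul_one_of_commute
  · intro j
    rw [annihilate_eq_majorana]
    exact ((h _).smul_right _).add_right ((h _).smul_right _)
  · intro j
    rw [create_eq_majorana]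
    exact ((h _).smul_right _).add_right ((h _).smul_right _)

/-! ## Unitaries implementing rotations of the Majorana operators -/

/-- The unitary `U` implements the linear map `R` on the span of the Majorana operators:
`U γ_a U† = ∑_b R_{ba} γ_b`. -/
structure Implements {n : ℕ} (U : Op n) (R : Matrix (Fin n × Bool) (Fin n × Bool) ℝ) : Prop where
  conjTranspose_mul : Uᴴ * U = 1
  mul_majorana : ∀ a, U * majorana a = (∑ b, (R b a : ℂ) • majorana b) * U

lemma Implements.mul_conjTranspose {n : ℕ} {U : Op n} {R : Matrix (Fin n × Bool) (Fin n × Bool) ℝ}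
    (h : Implements U R) : U * Uᴴ = 1 := mul_eq_one_comm.1 h.conjTranspose_mul

lemma implements_one {n : ℕ} : Implements (1 : Op n) 1 := by
  refine ⟨by simp, fun a => ?_⟩
  simp [Matrix.one_apply]

lemma Implements.mul {n : ℕ} {U V : Op n} {R S : Matrix (Fin n × Bool) (Fin n × Bool) ℝ}
    (hU : Implements U R) (hV : Implements V S) : Implements (U * V) (R * S) := by
  refine ⟨?_, fun a => ?_⟩
  · rw [Matrix.conjTranspose_mul, Matrix.mul_assoc, ← Matrix.mul_assoc Uᴴ, hU.conjTranspose_mul,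
      Matrix.one_mul, hV.conjTranspose_mul]
  · rw [Matrix.mul_assoc, hV.mul_majorana, ← Matrix.mul_assoc, Matrix.mul_sum, ← Matrix.mul_assoc]
    congr 1
    simp only [Matrix.mul_smul, hU.mul_majorana, Matrix.sum_mul, Finset.smul_sum, Matrix.smul_mul,
      smul_smul, Matrix.mul_apply, Complex.ofReal_sum, Complex.ofReal_mul, Finset.sum_smul]
    rw [Finset.sum_comm]
    simp only [mul_comm]

/-- Two unitaries that implement the same rotation agree up to a phase. -/
lemma Implements.exists_phase {n : ℕ} {U V : Op n}
    {R : Matrix (Fin n × Bool) (Fin n × Bool) ℝ}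
    (hU : Implements U R) (hV : Implements V R) (hR : IsRotation R) :
    ∃ φ : ℝ, |φ| ≤ Real.pi ∧ U = Complex.exp (φ * Complex.I) • V := by
  set W := U * Vᴴ with hW
  have hRR : R * Rᵀ = 1 := mul_eq_one_comm.1 hR.1
  -- Both unitaries conjugate `majorana a` to the same operator, so `U * Vᴴ` commutes with that
  -- operator.
  have hΓ : ∀ a, Commute W (∑ b, (R b a : ℂ) • majorana b) := by
    intro a
    have h1 : (∑ b, (R b a : ℂ) • majorana b) = V * majorana a * Vᴴ := by
      rw [hV.mul_majorana, Matrix.mul_assoc, hV.mul_conjTranspose, Matrix.mul_one]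
    have h2 : (∑ b, (R b a : ℂ) • majorana b) = U * majorana a * Uᴴ := by
      rw [hU.mul_majorana, Matrix.mul_assoc, hU.mul_conjTranspose, Matrix.mul_one]
    show W * _ = _ * W
    conv_rhs => rw [h2]
    rw [h1, hW]
    calc U * Vᴴ * (V * majorana a * Vᴴ) = U * (Vᴴ * V) * majorana a * Vᴴ := by
          simp only [Matrix.mul_assoc]
      _ = U * majorana a * (Uᴴ * U) * Vᴴ := by
          rw [hV.conjTranspose_mul, hU.conjTranspose_mul, Matrix.mul_one, Matrix.mul_one]
      _ = U * majorana a * Uᴴ * (U * Vᴴ) := by simp only [Matrix.mul_assoc]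
  -- Since R Rᵀ = 1, each Majorana operator is a combination of the rotated ones, with coefficients
  -- from row `c` of `R`.
  have hγ : ∀ c, Commute W (majorana c) := by
    intro c
    have h : majorana c = ∑ a, (R c a : ℂ) • ∑ b, (R b a : ℂ) • majorana b := by
      simp only [Finset.smul_sum, smul_smul]
      rw [Finset.sum_comm]
      simp only [← Finset.sum_smul]
      rw [Finset.sum_eq_single c]
      · have := congrFun (congrFun hRR c) c
        rw [Matrix.mul_apply, Matrix.one_apply_eq] at this
        simp only [Matrix.transpose_apply] at this
        rw [← one_smul ℂ (majorana c)]
        simp only [smul_smul, mul_one]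
        congr 1
        exact_mod_cast this.symm
      · intro b _ hb
        have := congrFun (congrFun hRR c) b
        rw [Matrix.mul_apply, Matrix.one_apply_ne hb.symm] at this
        simp only [Matrix.transpose_apply] at this
        have h' : ∑ a, (R c a : ℂ) * (R b a : ℂ) = 0 := by exact_mod_cast this
        rw [h', zero_smul]
      · simp
    rw [h]
    exact Commute.sum_right _ _ _ fun a _ => (hΓ a).smul_right _
  have hs := eq_smul_one_of_commute_majorana W hγ
  set μ := W ∅ ∅ with hμ
  have hWW : Wᴴ * W = 1 := by
    rw [hW, Matrix.conjTranspose_mul, Matrix.conjTranspose_conjTranspose]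
    calc V * Uᴴ * (U * Vᴴ) = V * (Uᴴ * U) * Vᴴ := by simp only [Matrix.mul_assoc]
      _ = 1 := by rw [hU.conjTranspose_mul, Matrix.mul_one, hV.mul_conjTranspose]
  have hnorm : ‖μ‖ = 1 := by
    rw [hs] at hWW
    have := congrFun (congrFun hWW ∅) ∅
    simp only [Matrix.conjTranspose_smul, Matrix.conjTranspose_one,
      Matrix.mul_smul, Matrix.smul_apply, Matrix.one_apply_eq,
      smul_eq_mul, mul_one, Complex.star_def] at this
    rw [Complex.mul_conj, Complex.normSq_eq_norm_sq] at this
    have h2 : ‖μ‖ ^ 2 = 1 := by exact_mod_cast this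
    nlinarith [norm_nonneg μ]
  refine ⟨μ.arg, Complex.abs_arg_le_pi μ, ?_⟩
  have hexp : Complex.exp (μ.arg * Complex.I) = μ := by
    have := Complex.norm_mul_exp_arg_mul_I μ
    rwa [hnorm, Complex.ofReal_one, one_mul] at this
  rw [hexp]
  calc U = W * V := by rw [hW, Matrix.mul_assoc, hV.conjTranspose_mul, Matrix.mul_one]
    _ = μ • V := by rw [hs, Matrix.smul_mul, Matrix.one_mul]

/-! ## Exponentials implementing rotations -/

/-- Integration of the Heisenberg equation of motion. -/
lemma exp_mul_eq_of_hasDerivAt {𝔸 : Type*} [NormedRing 𝔸] [NormedAlgebra ℝ 𝔸] [CompleteSpace 𝔸]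
    [Algebra ℚ 𝔸] (X : 𝔸) (v : ℝ → 𝔸) (hv : ∀ s, HasDerivAt v (X * v s - v s * X) s) (t : ℝ) :
    NormedSpace.exp (t • X) * v 0 = v t * NormedSpace.exp (t • X) := by
  let : NormedAlgebra ℚ 𝔸 := NormedAlgebra.restrictScalars ℚ ℝ 𝔸
  -- The curve exp(-sX) v(s) exp(sX) is constant: the commutator in v' cancels the derivatives of
  -- the outer factors.
  have hd : ∀ s : ℝ, HasDerivAt (fun s : ℝ => NormedSpace.exp (s • (-X)) * v s *
      NormedSpace.exp (s • X)) 0 s := by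
    intro s
    have h1 := hasDerivAt_exp_smul_const (𝕂 := ℝ) (-X) s
    have h2 := hasDerivAt_exp_smul_const' (𝕂 := ℝ) X s
    refine ((h1.fun_mul (hv s)).fun_mul h2).congr_deriv ?_
    noncomm_ring
  have hconst := is_const_of_deriv_eq_zero (fun s => (hd s).differentiableAt)
    (fun s => (hd s).deriv) t 0
  simp only [zero_smul, NormedSpace.exp_zero, one_mul, mul_one] at hconst
  rw [← hconst, smul_neg, ← mul_assoc, ← mul_assoc,
    ← NormedSpace.exp_add_of_commute (Commute.refl (t • X)).neg_right, add_neg_cancel,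
    NormedSpace.exp_zero, one_mul]

open scoped Matrix.Norms.Operator in
lemma conjTranspose_exp_mul_exp {n : ℕ} {X : Op n} (hX : Xᴴ = -X) :
    (NormedSpace.exp X)ᴴ * NormedSpace.exp X = 1 := by
  rw [← Matrix.exp_conjTranspose, hX, ← Matrix.exp_add_of_commute _ _ (Commute.refl X).neg_left,
    neg_add_cancel, NormedSpace.exp_zero]

/-- `X` acts on the Majorana operators by commutators as a real antisymmetric matrix. -/
def IsRotationGenerator {n : ℕ} (X : Op n) : Prop :=
  ∃ A : Matrix (Fin n × Bool) (Fin n × Bool) ℝ, Aᵀ = -A ∧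
    ∀ a, X * majorana a - majorana a * X = ∑ b, (A b a : ℂ) • majorana b

open scoped Matrix.Norms.Operator in
-- The curve ∑_b exp(sA)_{ba} γ_b starts at γ_a and satisfies v' = [X, v], so at s = 1 it is the
-- conjugate of γ_a by exp X.
lemma IsRotationGenerator.exists_implements {n : ℕ} {X : Op n} (h : IsRotationGenerator X)
    (hX : Xᴴ = -X) : ∃ R, IsRotation R ∧ Implements (NormedSpace.exp X) R := by
  obtain ⟨A, hA, hcomm⟩ := h
  refine ⟨NormedSpace.exp A, isRotation_exp hA, conjTranspose_exp_mul_exp hX, fun a => ?_⟩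
  have hentry : ∀ (b : Fin n × Bool) (s : ℝ), HasDerivAt
      (fun s : ℝ => (((NormedSpace.exp (s • A)) b a : ℝ) : ℂ))
      (((A * NormedSpace.exp (s • A)) b a : ℝ) : ℂ) s := by
    intro b s
    have h1 := hasDerivAt_exp_smul_const' (𝕂 := ℝ) A s
    have h2 := (Matrix.entryLinearMap ℝ ℝ b a).toContinuousLinearMap.hasFDerivAt.comp_hasDerivAt s h1
    exact HasDerivAt.ofReal_comp h2
  have hv := exp_mul_eq_of_hasDerivAt X
    (fun s : ℝ => ∑ b, (((NormedSpace.exp (s • A)) b a : ℝ) : ℂ) • majorana b) (by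
      intro s
      have h := HasDerivAt.fun_sum (u := Finset.univ)
        (fun (b : Fin n × Bool) _ => (hentry b s).smul_const (majorana b))
      refine h.congr_deriv ?_
      rw [Finset.mul_sum, Finset.sum_mul, ← Finset.sum_sub_distrib]
      simp only [mul_smul_comm, smul_mul_assoc, ← smul_sub, hcomm, Finset.smul_sum, smul_smul,
        Matrix.mul_apply, Complex.ofReal_sum, Complex.ofReal_mul, Finset.sum_smul]
      rw [Finset.sum_comm]
      simp only [mul_comm]) 1
  simp [NormedSpace.exp_zero, Matrix.one_apply] at hv
  exact hv

open scoped Matrix.Norms.Operator in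
/-- `e^{θ γ_b γ_a / 2}` implements the rotation by `θ` in the plane `(a, b)`. -/
lemma implements_planeRotation {n : ℕ} {a b : Fin n × Bool} (hab : a ≠ b) (θ : ℝ) :
    Implements (NormedSpace.exp (θ • ((1 / 2 : ℂ) • (majorana b * majorana a))))
      (planeRotation a b θ) := by
  set X : Op n := (1 / 2 : ℂ) • (majorana b * majorana a) with hX
  have hXs : (θ • X)ᴴ = -(θ • X) := by
    rw [hX]
    simp only [Matrix.conjTranspose_smul, Matrix.conjTranspose_mul, conjTranspose_majorana]
    rw [majorana_mul_of_ne hab]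
    simp
  -- Anticommutation makes the two terms of the commutator add, which the factor 1/2 compensates.
  -- Thus X acts as the infinitesimal rotation γ_a ↦ γ_b, γ_b ↦ -γ_a and kills the other Majorana
  -- operators.
  have hXa : X * majorana a - majorana a * X = majorana b := by
    rw [hX, smul_mul_assoc, mul_smul_comm, mul_assoc, majorana_mul_self, ← mul_assoc,
      majorana_mul_of_ne hab, neg_mul, mul_assoc, majorana_mul_self, mul_one]
    module
  have hXb : X * majorana b - majorana b * X = -majorana a := by
    rw [hX, smul_mul_assoc, mul_smul_comm, ← mul_assoc (majorana b) (majorana b),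
      majorana_mul_self, mul_assoc, majorana_mul_of_ne hab, mul_neg, ← mul_assoc,
      majorana_mul_self, one_mul]
    module
  have hXc : ∀ c, c ≠ a → c ≠ b → X * majorana c - majorana c * X = 0 := by
    intro c hca hcb
    rw [hX, smul_mul_assoc, mul_smul_comm, mul_assoc, majorana_mul_of_ne hca.symm, mul_neg,
      ← mul_assoc, majorana_mul_of_ne hcb.symm, neg_mul, neg_neg, mul_assoc, sub_self]
  clear_value X
  have hcos : ∀ s : ℝ, HasDerivAt (fun s : ℝ => ((Real.cos s : ℝ) : ℂ)) ((-Real.sin s : ℝ) : ℂ) s :=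
    fun s => (Real.hasDerivAt_cos s).ofReal_comp
  have hsin : ∀ s : ℝ, HasDerivAt (fun s : ℝ => ((Real.sin s : ℝ) : ℂ)) ((Real.cos s : ℝ) : ℂ) s :=
    fun s => (Real.hasDerivAt_sin s).ofReal_comp
  refine ⟨conjTranspose_exp_mul_exp hXs, fun c => ?_⟩
  have hsum : ∑ d, ((planeRotation a b θ d c : ℝ) : ℂ) • majorana d =
      if c = a then (Real.cos θ : ℂ) • majorana a + (Real.sin θ : ℂ) • majorana b
      else if c = b then (-Real.sin θ : ℂ) • majorana a + (Real.cos θ : ℂ) • majorana b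
      else majorana c := by
    have hrow : ∀ d, ((planeRotation a b θ d c : ℝ) : ℂ) • majorana d =
        (if d = a then (if c = a then (Real.cos θ : ℂ) else if c = b then (-Real.sin θ : ℂ) else 0) •
          majorana a else 0) +
        (if d = b then (if c = a then (Real.sin θ : ℂ) else if c = b then (Real.cos θ : ℂ) else 0) •
          majorana b else 0) +
        (if d = c then (if c = a then 0 else if c = b then 0 else majorana c) else 0) := by
      intro d
      simp only [planeRotation, Matrix.of_apply]
      by_cases hda : d = a
      · subst hda
        by_cases hcd : c = d
        · subst hcd; simp [hab]
        · by_cases hcb : c = b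
          · subst hcb; simp [hab, hcd]
          · simp [hab, hcd, hcb, Ne.symm hcd]
      · by_cases hdb : d = b
        · subst hdb
          by_cases hcd : c = d
          · subst hcd; simp [hda]
          · by_cases hca : c = a
            · subst hca; simp [hda, hcd]
            · simp [hda, hca, hcd, Ne.symm hcd]
        · by_cases hcd : c = d
          · subst hcd; simp [hda, hdb]
          · simp [hda, hdb, hcd, Ne.symm hcd]
    simp only [hrow, Finset.sum_add_distrib, Finset.sum_ite_eq', Finset.mem_univ, if_true]
    split_ifs <;> simp
  rw [hsum]
  by_cases hca : c = a
  · subst hca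
    have := exp_mul_eq_of_hasDerivAt X
      (fun s : ℝ => (Real.cos s : ℂ) • majorana c + (Real.sin s : ℂ) • majorana b) (by
        intro s
        refine (((hcos s).smul_const (majorana c)).fun_add
          ((hsin s).smul_const (majorana b))).congr_deriv ?_
        rw [mul_add, add_mul, mul_smul_comm, mul_smul_comm, smul_mul_assoc, smul_mul_assoc,
          add_sub_add_comm, ← smul_sub, ← smul_sub, hXa, hXb]
        push_cast
        module) θ
    simp at this ⊢
    exact this
  · rw [if_neg hca]
    by_cases hcb : c = b
    · subst hcb
      have := exp_mul_eq_of_hasDerivAt X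
        (fun s : ℝ => (-Real.sin s : ℂ) • majorana a + (Real.cos s : ℂ) • majorana c) (by
          intro s
          refine ((hsin s).fun_neg.smul_const (majorana a)).fun_add
            ((hcos s).smul_const (majorana c)) |>.congr_deriv ?_
          rw [mul_add, add_mul, mul_smul_comm, mul_smul_comm, smul_mul_assoc, smul_mul_assoc,
            add_sub_add_comm, ← smul_sub, ← smul_sub, hXa, hXb]
          push_cast
          module) θ
      simp at this ⊢
      exact this
    · rw [if_neg hcb]
      have hc : Commute (θ • X) (majorana c) := by
        have : Commute X (majorana c) := sub_eq_zero.1 (hXc c hca hcb)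
        exact this.smul_left θ
      exact (SemiconjBy.exp_right hc.symm).symm

/-! ## Implementable unitaries -/

/-- `U` is implemented by a circuit of at most `k` gates generated by monomials of weight `2`. -/
def Implementable {n : ℕ} (k : ℕ) (U : Op n) : Prop :=
  ∃ C : Circuit n, C.InModel (termObservables 2) ∧ C.length ≤ k ∧ circuitOp C = U

lemma implementable_one {n : ℕ} : Implementable 0 (1 : Op n) :=
  ⟨[], by simp [Circuit.InModel], le_rfl, by simp [circuitOp]⟩

lemma Implementable.mono {n k l : ℕ} {U : Op n} (h : Implementable k U) (hkl : k ≤ l) :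
    Implementable l U := by
  obtain ⟨C, h1, h2, h3⟩ := h
  exact ⟨C, h1, h2.trans hkl, h3⟩

lemma Implementable.mul {n k l : ℕ} {U V : Op n} (hU : Implementable k U)
    (hV : Implementable l V) : Implementable (k + l) (U * V) := by
  obtain ⟨C, h1, h2, h3⟩ := hU
  obtain ⟨D, h4, h5, h6⟩ := hV
  refine ⟨C ++ D, ?_, ?_, ?_⟩
  · intro g hg
    rcases List.mem_append.1 hg with h | h
    · exact h1 g h
    · exact h4 g h
  · rw [List.length_append]; exact add_le_add h2 h5
  · rw [circuitOp, List.map_append, List.prod_append, ← h3, ← h6]; rfl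

lemma Implementable.pow {n k : ℕ} {U : Op n} (hU : Implementable k U) (m : ℕ) :
    Implementable (k * m) (U ^ m) := by
  induction m with
  | zero => exact implementable_one
  | succ m ih => rw [pow_succ]; exact ih.mul hU

/-- A gate with a phase of modulus at most `k` is the product of `k` elementary gates. -/
lemma implementable_exp_observable {n : ℕ} {O : Op n} (hO : O ∈ termObservables 2 n) {θ : ℝ}
    {k : ℕ} (hk : 0 < k) (hθ : |θ| ≤ k) :
    Implementable k (NormedSpace.exp ((-(Complex.I * (θ : ℂ))) • O)) := by
  have hk' : (0 : ℝ) < k := by exact_mod_cast hk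
  have h1 : Implementable 1 (NormedSpace.exp ((-(Complex.I * ((θ / k : ℝ) : ℂ))) • O)) := by
    refine ⟨[⟨O, θ / k⟩], ?_, le_rfl, ?_⟩
    · intro g hg
      rw [List.mem_singleton] at hg
      subst hg
      refine ⟨hO, ?_⟩
      rw [abs_div, abs_of_pos hk', div_le_one hk']; exact hθ
    · simp [circuitOp, Gate.unitary]
  have h2 := h1.pow k
  rw [← Matrix.exp_nsmul, one_mul, ← Nat.cast_smul_eq_nsmul ℂ, smul_smul] at h2
  have h3 : (k : ℂ) * -(Complex.I * ((θ / k : ℝ) : ℂ)) = -(Complex.I * (θ : ℂ)) := by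
    have : (k : ℂ) ≠ 0 := by exact_mod_cast hk.ne'
    push_cast
    field_simp
  rwa [h3] at h2

lemma pairing_mem_termObservables {n : ℕ} (i j : Fin n) {a : ℂ} (ha : ‖a‖ ≤ 1) :
    a • (annihilate i * annihilate j) + (a • (annihilate i * annihilate j))ᴴ
      ∈ termObservables 2 n :=
  ⟨0, 2, ![], ![i, j], a, rfl, ha, by simp [monomialOp, List.ofFn_succ]⟩

lemma hopping_mem_termObservables {n : ℕ} (i j : Fin n) {a : ℂ} (ha : ‖a‖ ≤ 1) :
    a • (create i * annihilate j) + (a • (create i * annihilate j))ᴴ ∈ termObservables 2 n :=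
  ⟨1, 1, ![i], ![j], a, rfl, ha, by simp [monomialOp, List.ofFn_succ]⟩

/-- An observable contains its monomial plus the adjoint, so the self-adjoint number operator is
obtained with coefficient 1/2. -/
lemma number_mem_termObservables {n : ℕ} (i : Fin n) :
    create i * annihilate i ∈ termObservables 2 n := by
  have h := hopping_mem_termObservables i i (a := 1 / 2) (by norm_num)
  have h2 : (1 / 2 : ℂ) • (create i * annihilate i) + ((1 / 2 : ℂ) • (create i * annihilate i))ᴴ
      = create i * annihilate i := by
    simp only [Matrix.conjTranspose_smul, Matrix.conjTranspose_mul, conjTranspose_annihilate,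
      conjTranspose_create]
    simp only [star_div₀, star_one, star_ofNat, ← add_smul]
    norm_num
  rwa [h2] at h

open scoped Matrix.Norms.Operator in
lemma exp_smul_one_add {n : ℕ} (z : ℂ) (X : Op n) :
    NormedSpace.exp (z • (1 : Op n) + X) = Complex.exp z • NormedSpace.exp X := by
  rw [Matrix.exp_add_of_commute _ _ ((Commute.one_left X).smul_left z)]
  have : NormedSpace.exp (z • (1 : Op n)) = Complex.exp z • (1 : Op n) := by
    rw [Matrix.smul_one_eq_diagonal, Matrix.exp_diagonal, Matrix.smul_one_eq_diagonal]
    congr 1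
    funext S
    rw [Pi.coe_exp, ← Complex.exp_eq_exp_ℂ]
  rw [this, smul_mul_assoc, one_mul]

lemma Implements.smul {n : ℕ} {U : Op n} {R : Matrix (Fin n × Bool) (Fin n × Bool) ℝ}
    (h : Implements U R) (φ : ℝ) : Implements (Complex.exp (φ * Complex.I) • U) R := by
  refine ⟨?_, fun a => ?_⟩
  · rw [Matrix.conjTranspose_smul, Matrix.smul_mul, Matrix.mul_smul, smul_smul,
      h.conjTranspose_mul, Complex.star_def, ← Complex.normSq_eq_conj_mul_self,
      Complex.normSq_eq_norm_sq, Complex.norm_exp_ofReal_mul_I]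
    simp
  · rw [smul_mul_assoc, h.mul_majorana, mul_smul_comm]

lemma majorana_true_mul_false {n : ℕ} (i : Fin n) :
    majorana (i, true) * majorana (i, false)
      = Complex.I • (1 - (2 : ℂ) • (create i * annihilate i)) := by
  have h := annihilate_create_anticomm i i
  rw [if_pos rfl] at h
  have h' : annihilate i * create i = 1 - create i * annihilate i := eq_sub_of_add_eq h
  simp only [majorana, majoranaPhase, if_true, Bool.false_eq_true, if_false, star_one, one_smul,
    Complex.star_def, Complex.conj_I, add_mul, mul_add, smul_mul_assoc, annihilate_sq, create_sq,
    h']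
  module

/-- The four terms group into a pairing part and a hopping part, each skew-Hermitian and hence
generating a gate from a single monomial. -/
lemma majorana_mul_majorana_of_ne {n : ℕ} {i j : Fin n} (hij : i ≠ j) (x y : Bool) :
    majorana (j, y) * majorana (i, x) =
      ((majoranaPhase y * majoranaPhase x) • (annihilate j * annihilate i)
        - ((majoranaPhase y * majoranaPhase x) • (annihilate j * annihilate i))ᴴ)
      + ((star (majoranaPhase y) * majoranaPhase x) • (create j * annihilate i)
        - ((star (majoranaPhase y) * majoranaPhase x) • (create j * annihilate i))ᴴ) := by
  have h1 : annihilate j * create i = -(create i * annihilate j) := by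
    have := annihilate_create_anticomm j i
    rw [if_neg hij.symm] at this
    exact eq_neg_of_add_eq_zero_left this
  have h2 : create j * create i = -(create i * create j) :=
    eq_neg_of_add_eq_zero_left (create_anticomm j i)
  simp only [majorana, add_mul, mul_add, smul_mul_assoc, mul_smul_comm, h1, h2,
    Matrix.conjTranspose_smul, Matrix.conjTranspose_mul, conjTranspose_annihilate,
    conjTranspose_create, star_mul, star_star]
  module

/-- Every product of a pairing term with a hopping term, in either order, repeats a ladder operator
and so vanishes. Hence the exponential of the sum splits exactly, without a Trotter error. -/
lemma commute_pairing_hopping {n : ℕ} {i j : Fin n} (hij : i ≠ j) (a b : ℂ) :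
    Commute (a • (annihilate j * annihilate i) - (a • (annihilate j * annihilate i))ᴴ)
      (b • (create j * annihilate i) - (b • (create j * annihilate i))ᴴ) := by
  have c1 : annihilate i * create j = -(create j * annihilate i) := by
    have := annihilate_create_anticomm i j
    rw [if_neg hij] at this
    exact eq_neg_of_add_eq_zero_left this
  have c2 : annihilate j * create i = -(create i * annihilate j) := by
    have := annihilate_create_anticomm j i
    rw [if_neg hij.symm] at this
    exact eq_neg_of_add_eq_zero_left this
  have c3 : annihilate j * annihilate i = -(annihilate i * annihilate j) :=
    eq_neg_of_add_eq_zero_left (annihilate_anticomm j i)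
  have c4 : create j * create i = -(create i * create j) :=
    eq_neg_of_add_eq_zero_left (create_anticomm j i)
  have e1 : annihilate j * annihilate i * (create j * annihilate i) = 0 := by
    rw [mul_assoc, ← mul_assoc (annihilate i), c1, neg_mul, mul_assoc, annihilate_sq]; simp
  have e2 : annihilate j * annihilate i * (create i * annihilate j) = 0 := by
    rw [c3, neg_mul, mul_assoc, ← mul_assoc (annihilate j), c2, neg_mul, mul_assoc,
      annihilate_sq]; simp
  have e3 : create j * annihilate i * (annihilate j * annihilate i) = 0 := by
    rw [c3, mul_neg, mul_assoc, ← mul_assoc (annihilate i), annihilate_sq]; simp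
  have e4 : create i * annihilate j * (annihilate j * annihilate i) = 0 := by
    rw [mul_assoc, ← mul_assoc (annihilate j), annihilate_sq]; simp
  have f1 : create i * create j * (create j * annihilate i) = 0 := by
    rw [mul_assoc, ← mul_assoc (create j), create_sq]; simp
  have f2 : create i * create j * (create i * annihilate j) = 0 := by
    rw [← neg_neg (create i * create j), ← c4, neg_mul, mul_assoc, ← mul_assoc (create i),
      create_sq]; simp
  have f3 : create j * annihilate i * (create i * create j) = 0 := by
    rw [← neg_neg (create i * create j), ← c4, mul_neg, mul_assoc, ← mul_assoc (annihilate i),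
      c1, neg_mul, mul_neg, mul_assoc, ← mul_assoc (create j), create_sq]; simp
  have f4 : create i * annihilate j * (create i * create j) = 0 := by
    rw [mul_assoc, ← mul_assoc (annihilate j), c2, neg_mul, mul_neg, ← mul_assoc, ← mul_assoc,
      create_sq]; simp
  show _ * _ = _ * _
  simp only [Matrix.conjTranspose_smul, Matrix.conjTranspose_mul, conjTranspose_annihilate,
    conjTranspose_create, sub_mul, mul_sub, smul_mul_assoc, mul_smul_comm, e1, e2, e3, e4, f1, f2,
    f3, f4, smul_zero, sub_zero]

lemma norm_majoranaPhase (x : Bool) : ‖majoranaPhase x‖ = 1 := by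
  cases x <;> simp [majoranaPhase]

/-- The skew part of zM is -i times the observable with coefficient iz. Two gates share a phase of
modulus at most 2. -/
lemma implementable_exp_skew {n : ℕ} {M : Op n} {z : ℂ}
    (hM : (Complex.I * z) • M + ((Complex.I * z) • M)ᴴ ∈ termObservables 2 n) {θ : ℝ}
    (hθ : |θ| ≤ 2) : Implementable 2 (NormedSpace.exp (θ • (z • M - (z • M)ᴴ))) := by
  have h := implementable_exp_observable hM (k := 2) (by norm_num) (by exact_mod_cast hθ)
  convert h using 2
  have h1 : Complex.I * (θ : ℂ) * (Complex.I * z) = -(θ * z) := by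
    linear_combination (θ * z : ℂ) * Complex.I_sq
  have h2 : Complex.I * (θ : ℂ) * (star (Complex.I * z)) = θ * star z := by
    rw [star_mul, Complex.star_def, Complex.conj_I]
    linear_combination (-(θ * (starRingEnd ℂ) z) : ℂ) * Complex.I_sq
  rw [Matrix.conjTranspose_smul, Matrix.conjTranspose_smul, smul_add, smul_smul, smul_smul,
    neg_mul, neg_mul, h1, h2, neg_neg, smul_sub, ← Complex.coe_smul θ, ← Complex.coe_smul θ,
    smul_smul, smul_smul, neg_smul, sub_eq_add_neg]

lemma exists_implementable_planeRotation_of_ne {n : ℕ} {i j : Fin n} (hij : i ≠ j) (x y : Bool)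
    {θ : ℝ} (hθ : |θ| ≤ Real.pi) :
    ∃ U : Op n, Implements U (planeRotation (i, x) (j, y) θ) ∧ Implementable 4 U := by
  refine ⟨_, implements_planeRotation (by simp [hij]) θ, ?_⟩
  rw [majorana_mul_majorana_of_ne hij, smul_add]
  set P : Op n := (majoranaPhase y * majoranaPhase x) • (annihilate j * annihilate i)
        - ((majoranaPhase y * majoranaPhase x) • (annihilate j * annihilate i))ᴴ with hP
  set Q : Op n := (star (majoranaPhase y) * majoranaPhase x) • (create j * annihilate i)
        - ((star (majoranaPhase y) * majoranaPhase x) • (create j * annihilate i))ᴴ with hQ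
  have hPQ : Commute P Q := commute_pairing_hopping hij _ _
  have hsplit : θ • ((1 / 2 : ℂ) • P + (1 / 2 : ℂ) • Q) = (θ / 2) • P + (θ / 2) • Q := by
    simp only [← Complex.coe_smul, Complex.ofReal_div]
    push_cast
    module
  -- The generator carries the factor 1/2, so each part has phase at most π/2 and takes two gates.
  have hθ2 : |θ / 2| ≤ 2 := by
    rw [abs_div, abs_two]
    linarith [Real.pi_le_four]
  rw [hsplit, Matrix.exp_add_of_commute _ _ ((hPQ.smul_left _).smul_right _)]
  refine Implementable.mul (k := 2) (l := 2) ?_ ?_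
  · exact implementable_exp_skew
      (pairing_mem_termObservables _ _ (by simp [norm_majoranaPhase])) hθ2
  · exact implementable_exp_skew
      (hopping_mem_termObservables _ _ (by simp [norm_majoranaPhase])) hθ2

lemma exists_implementable_planeRotation_same_mode {n : ℕ} (i : Fin n) {x y : Bool} (hxy : x ≠ y)
    {θ : ℝ} (hθ : |θ| ≤ Real.pi) :
    ∃ U : Op n, Implements U (planeRotation (i, x) (i, y) θ) ∧ Implementable 4 U := by
  have hne : ((i, x) : Fin n × Bool) ≠ (i, y) := by simp [hxy]
  have key : ∃ σ : ℝ, |σ| = 1 ∧ (1 / 2 : ℂ) • (majorana (i, y) * majorana (i, x)) =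
      (σ * (Complex.I / 2)) • (1 : Op n) - (σ * Complex.I) • (create i * annihilate i) := by
    cases x <;> cases y
    · exact absurd rfl hxy
    · refine ⟨1, by simp, ?_⟩
      rw [majorana_true_mul_false]
      push_cast
      module
    · refine ⟨-1, by simp, ?_⟩
      rw [majorana_mul_of_ne (by simp), majorana_true_mul_false]
      push_cast
      module
    · exact absurd rfl hxy
  obtain ⟨σ, hσ, hX⟩ := key
  have hU := implements_planeRotation hne θ
  -- The constant in the generator contributes only a phase, which does not change the implemented
  -- rotation and is dropped. The remaining phase is at most π ≤ 4.
  refine ⟨NormedSpace.exp ((-(Complex.I * ((σ * θ : ℝ) : ℂ))) • (create i * annihilate i)), ?_,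
    implementable_exp_observable (number_mem_termObservables i) (by norm_num) ?_⟩
  · have h := hU.smul (-(σ * θ / 2))
    rw [← exp_smul_one_add] at h
    convert h using 2
    rw [hX, ← Complex.coe_smul θ]
    push_cast
    module
  · rw [abs_mul, hσ, one_mul]
    exact hθ.trans (by exact_mod_cast Real.pi_le_four)

lemma exists_implementable_planeRotation {n : ℕ} {a b : Fin n × Bool} (hab : a ≠ b) {θ : ℝ}
    (hθ : |θ| ≤ Real.pi) :
    ∃ U : Op n, Implements U (planeRotation a b θ) ∧ Implementable 4 U := by
  obtain ⟨i, x⟩ := a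
  obtain ⟨j, y⟩ := b
  by_cases hij : i = j
  · subst hij
    exact exists_implementable_planeRotation_same_mode i (fun h => hab (by rw [h])) hθ
  · exact exists_implementable_planeRotation_of_ne hij x y hθ

lemma IsPlaneRotationProduct.exists_implementable {n k : ℕ}
    {R : Matrix (Fin n × Bool) (Fin n × Bool) ℝ} (h : IsPlaneRotationProduct k R) :
    ∃ U : Op n, Implements U R ∧ Implementable (4 * k) U := by
  induction h with
  | one => exact ⟨1, implements_one, implementable_one⟩
  | rotation_mul a b θ hab hθ _ ih =>
    obtain ⟨U, hU, hU'⟩ := ih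
    obtain ⟨V, hV, hV'⟩ := exists_implementable_planeRotation hab hθ
    exact ⟨V * U, hV.mul hU, (hV'.mul hU').mono (by omega)⟩

/-- Every rotation of the Majorana operators is implemented by `O(n²)` gates. -/
lemma IsRotation.exists_implementable {n : ℕ} {R : Matrix (Fin n × Bool) (Fin n × Bool) ℝ}
    (hR : IsRotation R) : ∃ U : Op n, Implements U R ∧ Implementable (16 * n ^ 2) U := by
  obtain ⟨k, hk, hprod⟩ := hR.exists_isPlaneRotationProduct
  obtain ⟨U, hU, hU'⟩ := hprod.exists_implementable
  refine ⟨U, hU, hU'.mono ?_⟩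
  -- There are at most (2n)² plane rotations, of four gates each.
  simp only [Fintype.card_prod, Fintype.card_fin, Fintype.card_bool] at hk
  nlinarith

/-! ## Global phases -/

/-- A rotation by `π` that flips one Majorana operator of the mode `i` is a particle-hole
transformation of that mode. -/
lemma Implements.mul_number {n : ℕ} {i j : Fin n} (hij : i ≠ j) {Q : Op n}
    (hQ : Implements Q (planeRotation (i, true) (j, true) Real.pi)) :
    Q * (create i * annihilate i) = (1 - create i * annihilate i) * Q := by
  have ht : Q * majorana (i, true) = -(majorana (i, true) * Q) := by
    rw [hQ.mul_majorana, Finset.sum_eq_single (i, true)]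
    · simp [planeRotation]
    · rintro ⟨k, x⟩ - hne
      by_cases h : (k, x) = (j, true)
      · simp [planeRotation, h, hij.symm]
      · simp [planeRotation, hne, h, Ne.symm hne]
    · simp
  have hf : Q * majorana (i, false) = majorana (i, false) * Q := by
    rw [hQ.mul_majorana, Finset.sum_eq_single (i, false)]
    · simp [planeRotation, hij]
    · rintro ⟨k, x⟩ - hne
      by_cases h : (k, x) = (j, true)
      · simp [planeRotation, h, hij.symm]
      · by_cases h' : (k, x) = (i, true)
        · simp [planeRotation, h']
        · simp [planeRotation, h', h, Ne.symm hne]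
    · simp
  have hn : create i * annihilate i = (1 / 2 : ℂ) • (1 : Op n) +
      (Complex.I / 2) • (majorana (i, true) * majorana (i, false)) := by
    rw [majorana_true_mul_false, smul_smul]
    have : Complex.I / 2 * Complex.I = -(1 / 2) := by
      linear_combination (1 / 2 : ℂ) * Complex.I_sq
    rw [this]
    module
  have hprod : Q * (majorana (i, true) * majorana (i, false))
      = -(majorana (i, true) * majorana (i, false) * Q) := by
    rw [← mul_assoc, ht, neg_mul, mul_assoc, hf, mul_assoc]
  rw [hn, mul_add, mul_smul_comm, mul_smul_comm, hprod, sub_mul, add_mul, smul_mul_assoc,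
    smul_mul_assoc, one_mul, mul_one]
  module

open scoped Matrix.Norms.Operator in
-- If Q exchanges N and 1 - N, then exp(zN) Q exp(zN) Q = e^z Q², which is a scalar once Q² is.
-- Flipping one Majorana operator alone would have determinant -1, so Q also flips one of a second
-- mode.
lemma implementable_phase {n : ℕ} {i j : Fin n} (hij : i ≠ j) {φ : ℝ} (hφ : |φ| ≤ Real.pi) :
    Implementable 22 (Complex.exp (φ * Complex.I) • (1 : Op n)) := by
  obtain ⟨Q, hQ, hQ'⟩ := exists_implementable_planeRotation_of_ne hij true true
    (θ := Real.pi) (by rw [abs_of_pos Real.pi_pos])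
  -- The square rotates by 2π, so it implements the identity and is itself a phase `φ₀`.
  have hQQ : Implements (Q * Q) 1 := by
    have h := hQ.mul hQ
    have h2 : planeRotation (i, true) (j, true) (Real.pi + Real.pi) = 1 := by
      rw [← planeRotation_zero (i, true) (j, true)]
      simp [planeRotation, ← two_mul]
    rwa [planeRotation_mul_planeRotation (by simp [hij]), h2] at h
  obtain ⟨φ₀, hφ₀, hμ⟩ := hQQ.exists_phase implements_one ⟨by simp, by simp⟩
  set N : Op n := create i * annihilate i with hN
  -- Chosen so that e^z e^{iφ₀} = e^{iφ}.
  set z : ℂ := -(Complex.I * ((φ₀ - φ : ℝ) : ℂ)) with hz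
  have hsemi : Q * NormedSpace.exp (z • N) = Complex.exp z • (NormedSpace.exp (-(z • N)) * Q) := by
    have h : SemiconjBy Q (z • N) (z • (1 : Op n) + -(z • N)) := by
      show _ * _ = _ * _
      rw [mul_smul_comm, hQ.mul_number hij, ← smul_neg, ← smul_add, smul_mul_assoc, sub_eq_add_neg]
    have h2 : Q * NormedSpace.exp (z • N) = NormedSpace.exp (z • (1 : Op n) + -(z • N)) * Q :=
      SemiconjBy.exp_right h
    rw [h2, exp_smul_one_add, smul_mul_assoc]
  -- The phase is at most 2π < 7. Two such exponentials and two copies of Q give 22 gates.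
  have hgate : Implementable 7 (NormedSpace.exp (z • N)) := by
    refine implementable_exp_observable (number_mem_termObservables i) (by norm_num) ?_
    have := abs_sub φ₀ φ
    push_cast
    linarith [Real.pi_lt_d2]
  have htot := ((hgate.mul hQ').mul (hgate.mul hQ')).mono (show 7 + 4 + (7 + 4) ≤ 22 by norm_num)
  have hval : NormedSpace.exp (z • N) * Q * (NormedSpace.exp (z • N) * Q)
      = Complex.exp (φ * Complex.I) • (1 : Op n) := by
    calc NormedSpace.exp (z • N) * Q * (NormedSpace.exp (z • N) * Q)
        = NormedSpace.exp (z • N) * (Q * NormedSpace.exp (z • N)) * Q := by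
          simp only [mul_assoc]
      _ = Complex.exp z • (NormedSpace.exp (z • N) * NormedSpace.exp (-(z • N)) * (Q * Q)) := by
          rw [hsemi, mul_smul_comm, smul_mul_assoc]; simp only [mul_assoc]
      _ = Complex.exp z • (Complex.exp (φ₀ * Complex.I) • (1 : Op n)) := by
          rw [← Matrix.exp_add_of_commute _ _ (Commute.refl (z • N)).neg_right, add_neg_cancel,
            NormedSpace.exp_zero, one_mul, hμ]
      _ = Complex.exp (φ * Complex.I) • (1 : Op n) := by
          rw [smul_smul, ← Complex.exp_add, hz]
          congr 2
          push_cast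
          ring
  rwa [hval] at htot

/-! ## Quadratic Hamiltonians generate rotations -/

lemma IsRotationGenerator.zero {n : ℕ} : IsRotationGenerator (0 : Op n) :=
  ⟨0, by simp, by simp⟩

lemma IsRotationGenerator.add {n : ℕ} {X Y : Op n} (hX : IsRotationGenerator X)
    (hY : IsRotationGenerator Y) : IsRotationGenerator (X + Y) := by
  obtain ⟨A, hA, hXA⟩ := hX
  obtain ⟨B, hB, hYB⟩ := hY
  refine ⟨A + B, by rw [Matrix.transpose_add, hA, hB]; abel, fun a => ?_⟩
  rw [add_mul, mul_add, add_sub_add_comm, hXA, hYB]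
  simp only [Matrix.add_apply, Complex.ofReal_add, add_smul, Finset.sum_add_distrib]

lemma IsRotationGenerator.smul {n : ℕ} {X : Op n} (hX : IsRotationGenerator X) (r : ℝ) :
    IsRotationGenerator ((r : ℂ) • X) := by
  obtain ⟨A, hA, hXA⟩ := hX
  refine ⟨r • A, by rw [Matrix.transpose_smul, hA, smul_neg], fun a => ?_⟩
  rw [smul_mul_assoc, mul_smul_comm, ← smul_sub, hXA, Finset.smul_sum]
  simp only [Matrix.smul_apply, smul_eq_mul, Complex.ofReal_mul, smul_smul]

lemma isRotationGenerator_smul_one {n : ℕ} (z : ℂ) : IsRotationGenerator (z • (1 : Op n)) :=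
  ⟨0, by simp, by simp⟩

lemma isRotationGenerator_majorana_mul {n : ℕ} {a b : Fin n × Bool} (hab : a ≠ b) :
    IsRotationGenerator (majorana a * majorana b) := by
  refine ⟨Matrix.single a b 2 - Matrix.single b a 2, by simp, fun c => ?_⟩
  have hsum : ∑ d, (((Matrix.single a b 2 - Matrix.single b a 2 : Matrix _ _ ℝ) d c : ℝ) : ℂ) •
      majorana d = (if c = b then (2 : ℂ) else 0) • majorana a
        - (if c = a then (2 : ℂ) else 0) • majorana b := by
    have : ∀ d, (((Matrix.single a b 2 - Matrix.single b a 2 : Matrix _ _ ℝ) d c : ℝ) : ℂ) •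
        majorana d = (if d = a then (if c = b then (2 : ℂ) else 0) • majorana a else 0)
        - (if d = b then (if c = a then (2 : ℂ) else 0) • majorana b else 0) := by
      intro d
      simp only [Matrix.sub_apply, Matrix.single_apply]
      by_cases hda : d = a
      · subst hda; by_cases hcb : c = b <;> simp [hab, Ne.symm hab, hcb, Ne.symm]
      · by_cases hdb : d = b
        · subst hdb; by_cases hca : c = a <;> simp [hab, Ne.symm hab, hca, eq_comm (a := a)]
        · simp [hda, hdb, Ne.symm hda, Ne.symm hdb]
    simp only [this, Finset.sum_sub_distrib, Finset.sum_ite_eq', Finset.mem_univ, if_true]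
  rw [hsum]
  by_cases hca : c = a
  · subst hca
    rw [if_neg hab, if_pos rfl, mul_assoc, majorana_mul_of_ne hab.symm, mul_neg, ← mul_assoc,
      majorana_mul_self, one_mul]
    module
  · rw [if_neg hca]
    by_cases hcb : c = b
    · subst hcb
      rw [if_pos rfl, mul_assoc, majorana_mul_self, ← mul_assoc, majorana_mul_of_ne hab.symm,
        neg_mul, mul_assoc, majorana_mul_self, mul_one]
      module
    · rw [if_neg hcb, mul_assoc, majorana_mul_of_ne (Ne.symm hcb), mul_neg, ← mul_assoc,
        majorana_mul_of_ne (Ne.symm hca), neg_mul, neg_neg, mul_assoc]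
      simp

/-- The complex span of the Majorana operators. -/
def majoranaSpan (n : ℕ) : Submodule ℂ (Op n) := Submodule.span ℂ (Set.range majorana)

lemma majorana_mem_majoranaSpan {n : ℕ} (a : Fin n × Bool) : majorana a ∈ majoranaSpan n :=
  Submodule.subset_span ⟨a, rfl⟩

lemma annihilate_mem_majoranaSpan {n : ℕ} (j : Fin n) : annihilate j ∈ majoranaSpan n := by
  rw [annihilate_eq_majorana]
  exact add_mem (Submodule.smul_mem _ _ (majorana_mem_majoranaSpan _))
    (Submodule.smul_mem _ _ (majorana_mem_majoranaSpan _))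

lemma create_mem_majoranaSpan {n : ℕ} (j : Fin n) : create j ∈ majoranaSpan n := by
  rw [create_eq_majorana]
  exact add_mem (Submodule.smul_mem _ _ (majorana_mem_majoranaSpan _))
    (Submodule.smul_mem _ _ (majorana_mem_majoranaSpan _))

/-- Skew-Hermitian quadratic operators generate rotations of the Majorana operators. -/
lemma isRotationGenerator_of_mem {n : ℕ} {X : Op n} (hX : X ∈ majoranaSpan n * majoranaSpan n)
    (hskew : Xᴴ = -X) : IsRotationGenerator X := by
  -- The span is complex but the generators are closed only under real scalars. Inducting on the
  -- skew part of zX for all z absorbs complex scalars into z; on γ_aγ_b with a ≠ b the coefficient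
  -- becomes z + z̄, which is real.
  have key : ∀ z : ℂ, IsRotationGenerator (z • X - (z • X)ᴴ) := by
    rw [majoranaSpan, Submodule.span_mul_span] at hX
    clear hskew
    induction hX using Submodule.span_induction with
    | mem Y hY =>
      obtain ⟨_, ⟨a, rfl⟩, _, ⟨b, rfl⟩, rfl⟩ := hY
      intro z
      simp only [Matrix.conjTranspose_smul, Matrix.conjTranspose_mul, conjTranspose_majorana]
      by_cases hab : a = b
      · subst hab
        rw [majorana_mul_self, ← sub_smul]
        exact isRotationGenerator_smul_one _
      · rw [majorana_mul_of_ne (Ne.symm hab), smul_neg, sub_neg_eq_add, ← add_smul,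
          Complex.star_def, Complex.add_conj]
        exact_mod_cast (isRotationGenerator_majorana_mul hab).smul _
    | zero => intro z; simpa using IsRotationGenerator.zero
    | add Y Z _ _ hY hZ =>
      intro z
      have := (hY z).add (hZ z)
      rwa [← add_sub_add_comm, ← Matrix.conjTranspose_add, ← smul_add] at this
    | smul w Y _ hY =>
      intro z
      rw [smul_smul]; exact hY _
  have h := (key 1).smul (1 / 2)
  rw [one_smul, hskew, sub_neg_eq_add, ← two_smul ℂ, smul_smul] at h
  simpa using h

lemma quadraticHamiltonian_mem {n : ℕ} (α β : Matrix (Fin n) (Fin n) ℂ) :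
    quadraticHamiltonian α β ∈ majoranaSpan n * majoranaSpan n := by
  refine Submodule.sum_mem _ fun i _ => Submodule.sum_mem _ fun j _ => ?_
  refine sub_mem (add_mem ?_ ?_) ?_ <;> refine Submodule.smul_mem _ _ (Submodule.mul_mem_mul ?_ ?_)
  all_goals first | exact create_mem_majoranaSpan _ | exact annihilate_mem_majoranaSpan _

/-- Taking adjoints reverses each pair, and anticommutation restores the order with a sign, so the
two pairing sums are exchanged whatever `β` is. -/
lemma isHermitian_quadraticHamiltonian {n : ℕ} {α : Matrix (Fin n) (Fin n) ℂ}
    (hα : α.IsHermitian) (β : Matrix (Fin n) (Fin n) ℂ) :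
    (quadraticHamiltonian α β).IsHermitian := by
  have hcc : ∀ i j : Fin n, annihilate j * annihilate i = -(annihilate i * annihilate j) :=
    fun i j => eq_neg_of_add_eq_zero_left (annihilate_anticomm j i)
  have hdd : ∀ i j : Fin n, create j * create i = -(create i * create j) :=
    fun i j => eq_neg_of_add_eq_zero_left (create_anticomm j i)
  rw [Matrix.IsHermitian, quadraticHamiltonian]
  simp only [Matrix.conjTranspose_sum, Matrix.conjTranspose_add, Matrix.conjTranspose_sub,
    Matrix.conjTranspose_smul, Matrix.conjTranspose_mul, conjTranspose_annihilate,
    conjTranspose_create, star_star, hα.apply, Finset.sum_add_distrib, Finset.sum_sub_distrib]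
  rw [Finset.sum_comm (f := fun i j => α j i • (create j * annihilate i))]
  have hcc' : ∑ i, ∑ j, β i j • (annihilate j * annihilate i)
      = -∑ i, ∑ j, β i j • (annihilate i * annihilate j) := by
    rw [← Finset.sum_neg_distrib]
    refine Finset.sum_congr rfl fun i _ => ?_
    rw [← Finset.sum_neg_distrib]
    refine Finset.sum_congr rfl fun j _ => ?_
    rw [hcc i j, smul_neg]
  have hdd' : ∑ i, ∑ j, star (β i j) • (create j * create i)
      = -∑ i, ∑ j, star (β i j) • (create i * create j) := by
    rw [← Finset.sum_neg_distrib]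
    refine Finset.sum_congr rfl fun i _ => ?_
    rw [← Finset.sum_neg_distrib]
    refine Finset.sum_congr rfl fun j _ => ?_
    rw [hdd i j, smul_neg]
  rw [hcc', hdd']
  abel

/-! ## Circuits for the time evolution -/

lemma exp_smul_number {n : ℕ} (i : Fin n) (z : ℂ) :
    NormedSpace.exp (z • (create i * annihilate i)) =
      Matrix.diagonal fun S => if i ∈ S then Complex.exp z else 1 := by
  rw [create_mul_annihilate_eq_diagonal, ← Matrix.diagonal_smul, Matrix.exp_diagonal]
  congr 1
  funext S
  rw [Pi.coe_exp, ← Complex.exp_eq_exp_ℂ]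
  by_cases h : i ∈ S <;> simp [h]

/-- The number operator has integer spectrum, so an arbitrary phase may be reduced modulo 2π to one
of modulus at most π ≤ 4. -/
lemma implementable_exp_number {n : ℕ} (i : Fin n) (s : ℝ) :
    Implementable 4 (NormedSpace.exp ((-(Complex.I * (s : ℂ))) • (create i * annihilate i))) := by
  set z : ℂ := Complex.exp ((-s : ℝ) * Complex.I) with hz
  have h := implementable_exp_observable (number_mem_termObservables i) (θ := -z.arg) (k := 4)
    (by norm_num) (by
      rw [abs_neg]
      exact (Complex.abs_arg_le_pi z).trans (by exact_mod_cast Real.pi_le_four))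
  have harg : Complex.exp (z.arg * Complex.I) = z := by
    have := Complex.norm_mul_exp_arg_mul_I z
    rwa [hz, Complex.norm_exp_ofReal_mul_I, Complex.ofReal_one, one_mul] at this
  have h1 : Complex.exp (-(Complex.I * ((-z.arg : ℝ) : ℂ))) = Complex.exp (-(Complex.I * (s : ℂ))) := by
    calc _ = Complex.exp (z.arg * Complex.I) := by congr 1; push_cast; ring
      _ = _ := by rw [harg, hz]; congr 1; push_cast; ring
  rw [exp_smul_number, h1] at h
  rwa [exp_smul_number]

lemma evolution_skew {n : ℕ} {H : Op n} (hH : H.IsHermitian) (t : ℝ) :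
    ((-(Complex.I * (t : ℂ))) • H)ᴴ = -((-(Complex.I * (t : ℂ))) • H) := by
  rw [Matrix.conjTranspose_smul, hH.eq, ← neg_smul]
  simp [mul_comm]

/-- The evolution under a quadratic Hamiltonian is implemented exactly, for all times, by `O(n²)`
gates. -/
theorem implementable_evolution {n : ℕ} (hn : 1 ≤ n) {α : Matrix (Fin n) (Fin n) ℂ}
    (hα : α.IsHermitian) (β : Matrix (Fin n) (Fin n) ℂ) (t : ℝ) :
    Implementable (16 * n ^ 2 + 22) (evolution (quadraticHamiltonian α β) t) := by
  have hH := isHermitian_quadraticHamiltonian hα β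
  -- The phase construction needs two modes. With one mode the pairing terms vanish and the
  -- Hamiltonian is a real multiple of the number operator, whose evolution is implemented directly.
  rcases hn.eq_or_lt with rfl | hn
  · have hα0 : α 0 0 = ((α 0 0).re : ℂ) := by
      have := hα.apply 0 0
      exact (Complex.conj_eq_iff_re.1 this).symm
    have h := implementable_exp_number (0 : Fin 1) (t * (α 0 0).re)
    have hval : evolution (quadraticHamiltonian α β) t = NormedSpace.exp
        ((-(Complex.I * ((t * (α 0 0).re : ℝ) : ℂ))) • (create (0 : Fin 1) * annihilate 0)) := by
      rw [evolution, quadraticHamiltonian]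
      simp only [Fin.sum_univ_one, annihilate_sq, create_sq, smul_zero, add_zero, sub_zero]
      rw [hα0, smul_smul]
      simp [mul_assoc]
    rw [hval]
    exact h.mono (by norm_num)
  · have hskew := evolution_skew hH t
    obtain ⟨R, hR, hE⟩ := (isRotationGenerator_of_mem
      (Submodule.smul_mem _ _ (quadraticHamiltonian_mem α β)) hskew).exists_implements hskew
    obtain ⟨U, hU, hU'⟩ := hR.exists_implementable
    obtain ⟨φ, hφ, heq⟩ := hE.exists_phase hU hR
    have hij : (⟨0, by omega⟩ : Fin n) ≠ ⟨1, hn⟩ := by simp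
    have h := hU'.mul (implementable_phase hij hφ)
    rw [mul_smul_comm, mul_one, ← heq] at h
    exact h

lemma adjoinVacuum_zero {n : ℕ} (ψ : Fock n) : adjoinVacuum 0 ψ = ψ := by
  have hmap : ∀ S : Finset (Fin n), S.map (Fin.castAddEmb 0) = S := by
    intro S
    have : (Fin.castAddEmb 0 : Fin n ↪ Fin (n + 0)) = Function.Embedding.refl _ := by ext; rfl
    rw [this]
    exact Finset.map_refl
  ext T
  rw [adjoinVacuum]
  simp only [hmap, WithLp.ofLp_sum, Finset.sum_apply, PiLp.smul_apply, PiLp.single_apply,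
    smul_eq_mul, mul_ite, mul_one, mul_zero]
  simp

lemma termObservables_subset_fermionicModel {d w : ℕ} (h : d ≤ w) (n : ℕ) :
    termObservables d n ⊆ fermionicModel w n := fun _ hO => ⟨d, h, hO⟩

lemma FamilySimulates.mono_model {𝔥 𝔥' : Model} (h : ∀ n, 𝔥 n ⊆ 𝔥' n) {H : ∀ n, Op n}
    {V : CircuitFamily} {T ε : ℕ → ℝ} {G : ℕ → ℕ} (hV : FamilySimulates 𝔥 H V T ε G) :
    FamilySimulates 𝔥' H V T ε G := fun n hn t ht ht' =>
  let ⟨h1, h2⟩ := hV n hn t ht ht'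
  ⟨fun g hg => ⟨h _ (h1 g hg).1, (h1 g hg).2⟩, h2⟩

/-- Exactly implementable evolutions are simulated by circuits without ancillary modes. -/
lemma exists_familySimulates {H : ∀ n, Op n} {G : ℕ → ℕ}
    (h : ∀ n, 1 ≤ n → ∀ t : ℝ, Implementable (G n) (evolution (H n) t)) (T : ℕ → ℝ)
    {ε : ℕ → ℝ} (hε : ∀ n, 0 ≤ ε n) :
    ∃ V, FamilySimulates (termObservables 2) H V T ε G := by
  have h' : ∀ n, ∃ C : ℝ → Circuit n, 1 ≤ n → ∀ t, (C t).InModel (termObservables 2) ∧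
      (C t).length ≤ G n ∧ circuitOp (C t) = evolution (H n) t := by
    intro n
    by_cases hn : 1 ≤ n
    · choose C hC using h n hn
      exact ⟨C, fun _ => hC⟩
    -- A family needs a circuit at n = 0 too, where nothing is required of it.
    · exact ⟨fun _ => [], fun hn' => absurd hn' hn⟩
  choose C hC using h'
  refine ⟨⟨fun _ => 0, C⟩, fun n hn t _ _ => ?_⟩
  obtain ⟨h1, h2, h3⟩ := hC n hn t
  refine ⟨h1, h2, fun ψ _ => ?_⟩
  rw [adjoinVacuum_zero, adjoinVacuum_zero]
  have h4 : circuitOp (n := n + 0) (C n t) = evolution (H n) t := h3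
  rw [h4]
  simpa using hε n

/-! ## Quadratic Hamiltonians are fermionic Hamiltonians of weight two -/

/-- The coefficients of a quadratic Hamiltonian in the normally ordered monomials. -/
def quadraticCoeff {n : ℕ} (α β : Matrix (Fin n) (Fin n) ℂ) :
    ∀ p q : ℕ, (Fin p → Fin n) → (Fin q → Fin n) → ℂ
  | 1, 1, I, J => α (I 0) (J 0)
  | 0, 2, _, J => β (J 0) (J 1)
  | 2, 0, I, _ => -star (β (I 0) (I 1))
  | _, _, _, _ => 0

lemma norm_quadraticCoeff_le {n : ℕ} {α β : Matrix (Fin n) (Fin n) ℂ}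
    (hα : ∀ i j, ‖α i j‖ ≤ 1) (hβ : ∀ i j, ‖β i j‖ ≤ 1) (p q : ℕ) (I : Fin p → Fin n)
    (J : Fin q → Fin n) : ‖quadraticCoeff α β p q I J‖ ≤ 1 := by
  unfold quadraticCoeff
  split
  · exact hα _ _
  · exact hβ _ _
  · rw [norm_neg, norm_star]; exact hβ _ _
  · simp

lemma quadraticCoeff_eq_zero {n : ℕ} (α β : Matrix (Fin n) (Fin n) ℂ) {p q : ℕ} (h : p + q ≠ 2)
    (I : Fin p → Fin n) (J : Fin q → Fin n) : quadraticCoeff α β p q I J = 0 := by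
  unfold quadraticCoeff
  split
  · exact absurd rfl h
  · exact absurd rfl h
  · exact absurd rfl h
  · rfl

lemma sum_fin_two_arrow {κ M : Type*} [Fintype κ] [AddCommMonoid M] (f : (Fin 2 → κ) → M) :
    ∑ I, f I = ∑ i, ∑ j, f ![i, j] := by
  rw [← Fintype.sum_prod_type']
  exact Fintype.sum_equiv (finTwoArrowEquiv κ) _ _ fun I => by
    congr 1; funext k; fin_cases k <;> rfl

lemma sum_fin_one_arrow {κ M : Type*} [Fintype κ] [AddCommMonoid M] (f : (Fin 1 → κ) → M) :
    ∑ I, f I = ∑ i, f ![i] :=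
  Fintype.sum_equiv (Equiv.funUnique (Fin 1) κ) _ _ fun I => by
    congr 1; funext k; fin_cases k; rfl

lemma sum_range_weight_two {M : Type*} [AddCommMonoid M] {F : ℕ → ℕ → M}
    (hF : ∀ p q, p + q ≠ 2 → F p q = 0) {v : ℕ} (hv : 2 ≤ v) :
    ∑ p ∈ Finset.range (v + 1), ∑ q ∈ Finset.range (v + 1 - p), F p q
      = F 0 2 + F 1 1 + F 2 0 := by
  rw [Finset.sum_sigma' (Finset.range (v + 1)) (fun p => Finset.range (v + 1 - p))]
  rw [← Finset.sum_subset (s₁ := {⟨0, 2⟩, ⟨1, 1⟩, ⟨2, 0⟩})]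
  · rw [Finset.sum_insert (by simp), Finset.sum_insert (by simp), Finset.sum_singleton, add_assoc]
  · intro x hx
    simp only [Finset.mem_insert, Finset.mem_singleton] at hx
    rcases hx with rfl | rfl | rfl <;>
      simp only [Finset.mem_sigma, Finset.mem_range] <;> omega
  · rintro ⟨p, q⟩ - hx
    refine hF p q fun hpq => hx ?_
    have : p ≤ 2 := by omega
    interval_cases p
    · obtain rfl : q = 2 := by omega
      simp
    · obtain rfl : q = 1 := by omega
      simp
    · obtain rfl : q = 0 := by omega
      simp

lemma quadraticHamiltonian_mem_fermionicClass {n v : ℕ} (hv : 2 ≤ v)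
    {α β : Matrix (Fin n) (Fin n) ℂ} (hα : α.IsHermitian) (hα1 : ∀ i j, ‖α i j‖ ≤ 1)
    (hβ1 : ∀ i j, ‖β i j‖ ≤ 1) : quadraticHamiltonian α β ∈ fermionicClass v n := by
  refine ⟨isHermitian_quadraticHamiltonian hα β, quadraticCoeff α β,
    norm_quadraticCoeff_le hα1 hβ1, ?_⟩
  rw [sum_range_weight_two
    (F := fun p q => ∑ I : Fin p → Fin n, ∑ J : Fin q → Fin n,
      quadraticCoeff α β p q I J • monomialOp I J)
    (fun p q hpq => by simp [quadraticCoeff_eq_zero α β hpq]) hv]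
  simp only [sum_fin_two_arrow, sum_fin_one_arrow, Fintype.sum_unique]
  simp only [quadraticCoeff, monomialOp, List.ofFn_succ, List.ofFn_zero, List.prod_cons,
    List.prod_nil, mul_one, one_mul, Matrix.cons_val_zero, Matrix.cons_val_one, Fin.succ_zero_eq_one,
    neg_smul, Finset.sum_neg_distrib, quadraticHamiltonian, Finset.sum_add_distrib,
    Finset.sum_sub_distrib]
  abel

/-! ## Comparison with the no-fast-forwarding line -/

lemma tendsto_div_of_le_const_mul {G : ℕ → ℕ} {f : ℕ → ℝ} {l : ℕ → ℝ≥0∞} {K : ℝ}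
    (hK : 0 ≤ K) (hG : ∀ n, 1 ≤ n → (G n : ℝ) ≤ K * f n)
    (h : Tendsto (fun n => ENNReal.ofReal (f n) / l n) atTop (𝓝 0)) :
    Tendsto (fun n => (G n : ℝ≥0∞) / l n) atTop (𝓝 0) := by
  have h1 := ENNReal.Tendsto.const_mul (a := ENNReal.ofReal K) h (Or.inr ENNReal.ofReal_ne_top)
  rw [mul_zero] at h1
  refine tendsto_of_tendsto_of_tendsto_of_le_of_le' tendsto_const_nhds h1
    (Eventually.of_forall fun _ => zero_le) ?_
  filter_upwards [eventually_ge_atTop 1] with n hn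
  rw [← mul_div_assoc, ← ENNReal.ofReal_mul hK]
  refine ENNReal.div_le_div_right ?_ _
  rw [← ENNReal.ofReal_natCast]
  exact ENNReal.ofReal_le_ofReal (hG n hn)

/-- The quotient is at most (log τ / c) · n² / τⁿ, since log τⁿ = n log τ cancels the factor n
below. -/
lemma tendsto_sq_mul_log_div {τ c : ℝ} (hτ : 1 < τ) (hc : 0 < c) {l : ℕ → ℝ≥0∞}
    (hl : ∀ᶠ n : ℕ in atTop, ENNReal.ofReal (c * ((n : ℝ) * τ ^ n)) ≤ l n) :
    Tendsto (fun n : ℕ => ENNReal.ofReal ((n : ℝ) ^ 2 * Real.log (τ ^ n)) / l n) atTop (𝓝 0) := by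
  have h1 : Tendsto (fun n : ℕ => (Real.log τ / c) * ((n : ℝ) ^ 2 / τ ^ n)) atTop (𝓝 0) := by
    simpa using (tendsto_pow_const_div_const_pow_of_one_lt 2 hτ).const_mul (Real.log τ / c)
  have h2 := ENNReal.tendsto_ofReal h1
  rw [ENNReal.ofReal_zero] at h2
  refine tendsto_of_tendsto_of_tendsto_of_le_of_le' tendsto_const_nhds h2
    (Eventually.of_forall fun _ => zero_le) ?_
  filter_upwards [hl, eventually_ge_atTop 1] with n hn hn1
  have hn0 : (0 : ℝ) < n := by exact_mod_cast hn1
  have hτn : 0 < τ ^ n := pow_pos (by linarith) n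
  calc _ ≤ ENNReal.ofReal ((n : ℝ) ^ 2 * Real.log (τ ^ n)) / ENNReal.ofReal (c * ((n : ℝ) * τ ^ n)) :=
        ENNReal.div_le_div_left hn _
    _ = ENNReal.ofReal ((n : ℝ) ^ 2 * Real.log (τ ^ n) / (c * ((n : ℝ) * τ ^ n))) :=
        (ENNReal.ofReal_div_of_pos (by positivity)).symm
    _ = _ := by
        congr 1
        rw [Real.log_pow]
        field_simp

lemma growsExponentially_of_le {τ c : ℝ} (hτ : 1 < τ) (hc : 0 < c) {l : ℕ → ℕ∞}
    (hl : ∀ᶠ n : ℕ in atTop, ENNReal.ofReal (c * ((n : ℝ) * τ ^ n)) ≤ (l n : ℝ≥0∞)) :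
    GrowsExponentially l := by
  refine ⟨c, τ, hc, hτ, ?_⟩
  filter_upwards [hl, eventually_ge_atTop 1] with n hn hn1
  refine le_trans (ENNReal.ofReal_le_ofReal ?_) hn
  have hn0 : (1 : ℝ) ≤ n := by exact_mod_cast hn1
  have hτn : 0 < τ ^ n := pow_pos (by linarith) n
  exact mul_le_mul_of_nonneg_left (le_mul_of_one_le_left hτn.le hn0) hc.le

end

end FermionFF

theorem theorem6 (ε τ : ℝ) (hε : 0 < ε) (hτ : 1 < τ) :
    ∃ G : ℕ → ℕ,
      (∃ K : ℝ, ∀ n : ℕ, 1 ≤ n → (G n : ℝ) ≤ K * ((n : ℝ) ^ 2 * Real.log (τ ^ n))) ∧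
      FermionFF.PolyBounded G ∧
      ∀ (α β : ∀ n : ℕ, Matrix (Fin n) (Fin n) ℂ),
        (∀ n, (α n).IsHermitian) →
        (∀ n i j, ‖α n i j‖ ≤ 1) →
        (∀ n i j, ‖β n i j‖ ≤ 1) →
        ∃ V : FermionFF.CircuitFamily,
          FermionFF.FamilySimulates (FermionFF.termObservables 2)
            (fun n => FermionFF.quadraticHamiltonian (α n) (β n)) V
            (fun n => τ ^ n) (fun _ => ε) G ∧
          ∀ w v : ℕ, 2 ≤ w → 2 ≤ v →
            (Tendsto (fun n : ℕ => ENNReal.ofReal ((n : ℝ) ^ 2 * Real.log (τ ^ n)) /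
                (FermionFF.noFFLine (FermionFF.fermionicModel w) (FermionFF.fermionicClass v)
                  (fun n => τ ^ n) (fun _ => ε) n : ℝ≥0∞)) atTop (𝓝 0) →
              FermionFF.FastForwards (FermionFF.fermionicModel w) (FermionFF.fermionicClass v)
                (fun n => FermionFF.quadraticHamiltonian (α n) (β n)) V
                (fun n => τ ^ n) (fun _ => ε) G) ∧
            ((∃ c : ℝ, 0 < c ∧ ∀ᶠ n : ℕ in atTop, ENNReal.ofReal (c * ((n : ℝ) * τ ^ n)) ≤
                (FermionFF.noFFLine (FermionFF.fermionicModel w) (FermionFF.fermionicClass v)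
                  (fun n => τ ^ n) (fun _ => ε) n : ℝ≥0∞)) →
              FermionFF.ExponentiallyFastForwards (FermionFF.fermionicModel w)
                (FermionFF.fermionicClass v)
                (fun n => FermionFF.quadraticHamiltonian (α n) (β n)) V
                (fun n => τ ^ n) (fun _ => ε) G) := by
  have hlog : 0 < Real.log τ := Real.log_pos hτ
  -- Here 38 = 16 + 22, as n² ≥ 1.
  have hquad : ∀ n : ℕ, 1 ≤ n → ((16 * n ^ 2 + 22 : ℕ) : ℝ) ≤ 38 * (n : ℝ) ^ 2 := by
    intro n hn
    have : (1 : ℝ) ≤ n := by exact_mod_cast hn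
    push_cast
    nlinarith
  have hG : ∀ n : ℕ, 1 ≤ n → ((16 * n ^ 2 + 22 : ℕ) : ℝ) ≤
      38 / Real.log τ * ((n : ℝ) ^ 2 * Real.log (τ ^ n)) := by
    intro n hn
    have h1 : (1 : ℝ) ≤ n := by exact_mod_cast hn
    -- As log τⁿ = n log τ, the claimed bound is cubic in n and leaves a factor n to spare.
    have h2 : 38 / Real.log τ * ((n : ℝ) ^ 2 * Real.log (τ ^ n)) = 38 * (n : ℝ) ^ 2 * n := by
      rw [Real.log_pow]; field_simp
    rw [h2]
    exact (hquad n hn).trans (le_mul_of_one_le_right (by positivity) h1)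
  have hpoly : FermionFF.PolyBounded (fun n => 16 * n ^ 2 + 22) := ⟨38, 2, hquad⟩
  refine ⟨fun n => 16 * n ^ 2 + 22, ⟨_, hG⟩, hpoly, fun α β hα hα1 hβ1 => ?_⟩
  obtain ⟨V, hV⟩ := FermionFF.exists_familySimulates
    (H := fun n => FermionFF.quadraticHamiltonian (α n) (β n)) (G := fun n => 16 * n ^ 2 + 22)
    (fun n hn t => FermionFF.implementable_evolution hn (hα n) (β n) t) (fun n => τ ^ n)
    (ε := fun _ => ε) (fun _ => hε.le)
  refine ⟨V, hV, fun w v hw hv => ?_⟩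
  have hfast : Tendsto (fun n : ℕ => ENNReal.ofReal ((n : ℝ) ^ 2 * Real.log (τ ^ n)) /
      (FermionFF.noFFLine (FermionFF.fermionicModel w) (FermionFF.fermionicClass v)
        (fun n => τ ^ n) (fun _ => ε) n : ℝ≥0∞)) atTop (𝓝 0) →
      FermionFF.FastForwards (FermionFF.fermionicModel w) (FermionFF.fermionicClass v)
        (fun n => FermionFF.quadraticHamiltonian (α n) (β n)) V
        (fun n => τ ^ n) (fun _ => ε) (fun n => 16 * n ^ 2 + 22) := fun h =>
    ⟨fun n _ => FermionFF.quadraticHamiltonian_mem_fermionicClass hv (hα n) (hα1 n) (hβ1 n),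
      hV.mono_model (FermionFF.termObservables_subset_fermionicModel hw),
      FermionFF.tendsto_div_of_le_const_mul (by positivity) hG h⟩
  refine ⟨hfast, fun ⟨c, hc, hl⟩ => ⟨hfast (FermionFF.tendsto_sq_mul_log_div hτ hc hl), hpoly,
    FermionFF.growsExponentially_of_le hτ hc hl⟩⟩
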